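/- Let $D_4$ and $Q_2$ denote the dihedral group and the quaternion group of order $8$. For groups $G,H$ with centers of order $2$, let $G\circ H$ be their central product, i.e. the quotient of $G\times H$ by $\{(x,y)\in Z(G)\times Z(H):\theta(x)y=1\}$, where $\theta:Z(G)\to Z(H)$ is the unique isomorphism; its center again has order $2$. Write $D_4^{(n)}=D_4\circ\cdots\circ D_4$ ($n$ factors, $n\ge 1$) and $Q_2D_4^{(n-1)}=Q_2\circ D_4\circ\cdots\circ D_4$ ($n-1$ factors $D_4$). A finite $2$-group $G$ is extraspecial if it is non-commutative, $[G,G]=\Phi(G)=Z(G)=\Omega(Z(G))$ and $|Z(G)|=2$, where $\Phi(G)$ is the Frattini subgroup and $\Omega(Z(G))=\langle x\in Z(G):x^2=1\rangle$. The quadratic form associated to an extraspecial $2$-group $G$ is the map $q:G/Z(G)\to Z(G)\cong\mathbb F_2$, $q(xZ(G))=x^2$. Let $[a,b]$ denote the form $ax^2+xy+by^2$ over $\mathbb F_2$ and $\perp$ the orthogonal sum. The Arf invariant of a regular quadratic form $q$ over a field $F$ of characteristic $2$ is the class of $\sum_i q(e_i)q(f_i)$ in $F/\{x^2+x:x\in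 F\}$, for any symplectic basis $\{e_i,f_i\}$ of the polar form of $q$. A group is real if every element is conjugate to its inverse, and strongly real if every element is a product $yz$ with $y^2=z^2=1$. A finite group is totally orthogonal if it is real and every irreducible finite-dimensional complex representation of it is realizable over $\mathbb R$ (that is, it has no symplectic representation). Then: 1. For every $n\ge 2$ the group $Q_2D_4^{(n-1)}$ is extraspecial, its associated quadratic form is isometric to $[1,1]\perp[0,0]\perp\cdots\perp[0,0]$ ($n-1$ copies of $[0,0]$), the Arf invariant of this form is non-trivial, and $Q_2D_4^{(n-1)}$ is strongly real but not totally orthogonal. 2. For every $n\ge 1$ the group $D_4^{(n)}$ is extraspecial, its associated quadratic form is isometric to $[0,0]\perp\cdots\perp[0,0]$ ($n$ copies), the Arf invariant of this form is trivial, and $D_4^{(n)}$ is both strongly real and totally orthogonal. -/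

import Mathlib

/-! ### Strongly real, real and totally orthogonal groups -/

/-- Every element is a product of two self-inverse elements. -/
def IsStronglyReal (G : Type*) [Group G] : Prop :=
  ∀ x : G, ∃ y z : G, y ^ 2 = 1 ∧ z ^ 2 = 1 ∧ x = y * z

/-- Every element is conjugate to its inverse. -/
def IsRealGroup (G : Type*) [Group G] : Prop :=
  ∀ x : G, IsConj x x⁻¹

/-- A finite-dimensional complex representation is realizable over `ℝ` if in some basis of the
space all group elements act by matrices with real entries. -/
def IsRealizableOverReal {G V : Type*} [Group G] [AddCommGroup V] [Module ℂ V]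
    (ρ : Representation ℂ G V) : Prop :=
  ∃ (d : ℕ) (b : Module.Basis (Fin d) ℂ V), ∀ (g : G) (i j : Fin d),
    ∃ r : ℝ, b.repr (ρ g (b j)) i = (r : ℂ)

/-- A real group without symplectic representations, i.e. all of whose irreducible
finite-dimensional complex representations are realizable over `ℝ`. (Up to isomorphism every
finite-dimensional representation lives on a space in `Type`.) -/
def IsTotallyOrthogonal (G : Type*) [Group G] : Prop :=
  IsRealGroup G ∧
    ∀ (V : Type) [AddCommGroup V] [Module ℂ V] [FiniteDimensional ℂ V]
      (ρ : Representation ℂ G V), ρ.IsIrreducible → IsRealizableOverReal ρ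

/-! ### Extraspecial `2`-groups -/

/-- A special `2`-group is a finite non-commutative `2`-group `G` with
`G' = Φ(G) = Z(G) = Ω(Z(G))`, where `Ω(Z(G))` is generated by the `x ∈ Z(G)` with `x² = 1`. -/
structure IsSpecialTwoGroup (G : Type*) [Group G] : Prop where
  finite : Finite G
  isPGroup : IsPGroup 2 G
  not_comm : ∃ x y : G, x * y ≠ y * x
  commutator_eq : commutator G = Subgroup.center G
  frattini_eq : frattini G = Subgroup.center G
  omega_eq : Subgroup.closure {x : G | x ∈ Subgroup.center G ∧ x ^ 2 = 1} = Subgroup.center G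

/-- An extraspecial `2`-group is a special `2`-group with center of order two. -/
structure IsExtraspecialTwoGroup (G : Type*) [Group G] : Prop where
  isSpecial : IsSpecialTwoGroup G
  card_center : Nat.card (Subgroup.center G) = 2

/-! ### Central products -/

section CentralProduct

variable {G H : Type*} [Group G] [Group H]

/-- The subgroup `{(x, y) ∈ Z(G) × Z(H) : θ(x) y = 1}` of `G × H`. -/
def centralKernel (θ : Subgroup.center G ≃* Subgroup.center H) : Subgroup (G × H) where
  carrier := {p | p.2 ∈ Subgroup.center H ∧
    ∃ h : p.1 ∈ Subgroup.center G, (θ ⟨p.1, h⟩ : H) * p.2 = 1}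
  one_mem' := by
    refine ⟨one_mem _, one_mem _, ?_⟩
    have h1 : (⟨(1 : G × H).1, one_mem _⟩ : Subgroup.center G) = 1 := rfl
    rw [h1, map_one]
    simp
  mul_mem' := by
    rintro ⟨a, b⟩ ⟨c, d⟩ ⟨hb, ha, hab⟩ ⟨hd, hc, hcd⟩
    refine ⟨mul_mem hb hd, mul_mem ha hc, ?_⟩
    have h1 : (⟨a * c, mul_mem ha hc⟩ : Subgroup.center G) = ⟨a, ha⟩ * ⟨c, hc⟩ := rfl
    have h2 := Subgroup.mem_center_iff.1 hb
    change (θ ⟨a, ha⟩ : H) * b = 1 at hab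
    change (θ ⟨c, hc⟩ : H) * d = 1 at hcd
    change (θ ⟨a * c, mul_mem ha hc⟩ : H) * (b * d) = 1
    rw [h1, map_mul, Subgroup.coe_mul, mul_assoc, ← mul_assoc _ b d, h2, mul_assoc, hcd, mul_one,
      hab]
  inv_mem' := by
    rintro ⟨a, b⟩ ⟨hb, ha, hab⟩
    refine ⟨inv_mem hb, inv_mem ha, ?_⟩
    have h1 : (⟨a⁻¹, inv_mem ha⟩ : Subgroup.center G) = ⟨a, ha⟩⁻¹ := rfl
    change (θ ⟨a, ha⟩ : H) * b = 1 at hab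
    change (θ ⟨a⁻¹, inv_mem ha⟩ : H) * b⁻¹ = 1
    rw [h1, map_inv, Subgroup.coe_inv, ← mul_inv_rev, Subgroup.mem_center_iff.1 (θ ⟨a, ha⟩).2 b,
      hab, inv_one]

theorem centralKernel_le_center (θ : Subgroup.center G ≃* Subgroup.center H) :
    centralKernel θ ≤ Subgroup.center (G × H) := by
  rintro ⟨a, b⟩ ⟨hb, ha, -⟩
  rw [Subgroup.mem_center_iff] at ha hb ⊢
  rintro ⟨c, d⟩
  exact Prod.ext (ha c) (hb d)

instance centralKernel_normal (θ : Subgroup.center G ≃* Subgroup.center H) :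
    (centralKernel θ).Normal where
  conj_mem n hn g := by
    have h := Subgroup.mem_center_iff.1 (centralKernel_le_center θ hn) g
    rwa [h, mul_inv_cancel_right]

/-- The central product of `G` and `H` along an isomorphism `θ` of their centers. -/
abbrev CentralProduct (θ : Subgroup.center G ≃* Subgroup.center H) : Type _ :=
  (G × H) ⧸ centralKernel θ

/-- The center of a central product is the image of the center of the second factor. -/
theorem card_center_centralProduct (θ : Subgroup.center G ≃* Subgroup.center H) :
    Nat.card (Subgroup.center (CentralProduct θ)) = Nat.card (Subgroup.center H) := by
  classical
  let f : Subgroup.center H → Subgroup.center (CentralProduct θ) := fun y =>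
    ⟨QuotientGroup.mk ((1 : G), (y : H)), by
      rw [Subgroup.mem_center_iff]
      intro z
      induction z using QuotientGroup.induction_on with
      | H p =>
        rw [← QuotientGroup.mk_mul, ← QuotientGroup.mk_mul]
        congr 1
        exact Prod.ext (by simp) (Subgroup.mem_center_iff.1 y.2 p.2)⟩
  refine (Nat.card_congr (Equiv.ofBijective f ⟨?_, ?_⟩)).symm
  · intro y y' h
    have h' : (QuotientGroup.mk ((1 : G), (y : H)) : CentralProduct θ)
        = QuotientGroup.mk ((1 : G), (y' : H)) := congrArg Subtype.val h
    rw [QuotientGroup.eq] at h'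
    obtain ⟨-, h₁, h₃⟩ := h'
    have e1 : (⟨(((1 : G), (y : H))⁻¹ * ((1 : G), (y' : H))).1, h₁⟩ : Subgroup.center G) = 1 :=
      Subtype.ext (by simp)
    rw [e1, map_one, Subgroup.coe_one, one_mul] at h₃
    exact Subtype.ext (inv_mul_eq_one.1 h₃)
  · rintro ⟨z, hz⟩
    induction z using QuotientGroup.induction_on with
    | H p =>
      obtain ⟨x, y⟩ := p
      have key : ∀ g : G × H, (g * (x, y))⁻¹ * ((x, y) * g) ∈ centralKernel θ := by
        intro g
        have := Subgroup.mem_center_iff.1 hz (QuotientGroup.mk g)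
        rw [← QuotientGroup.mk_mul, ← QuotientGroup.mk_mul, QuotientGroup.eq] at this
        exact this
      have hx : x ∈ Subgroup.center G := by
        rw [Subgroup.mem_center_iff]
        intro g
        obtain ⟨-, h₁, h₃⟩ := key (g, 1)
        have e2 : (((g, (1 : H)) * (x, y))⁻¹ * ((x, y) * (g, (1 : H)))).2 = 1 := by simp
        rw [e2, mul_one, OneMemClass.coe_eq_one, map_eq_one_iff θ θ.injective] at h₃
        exact inv_mul_eq_one.1 (congrArg Subtype.val h₃)
      have hy : y ∈ Subgroup.center H := by
        rw [Subgroup.mem_center_iff]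
        intro g
        obtain ⟨-, h₁, h₃⟩ := key (1, g)
        have e1 : (⟨((((1 : G), g) * (x, y))⁻¹ * ((x, y) * ((1 : G), g))).1, h₁⟩ :
            Subgroup.center G) = 1 := Subtype.ext (by simp)
        rw [e1, map_one, Subgroup.coe_one, one_mul] at h₃
        exact inv_mul_eq_one.1 h₃
      refine ⟨θ ⟨x, hx⟩ * ⟨y, hy⟩, Subtype.ext ?_⟩
      change (QuotientGroup.mk ((1 : G), (θ ⟨x, hx⟩ : H) * y) : CentralProduct θ)
        = QuotientGroup.mk (x, y)
      rw [QuotientGroup.eq]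
      have hc : ((θ ⟨x, hx⟩ : H) * y)⁻¹ * y = ((θ ⟨x, hx⟩)⁻¹ : Subgroup.center H) := by
        rw [← Subgroup.mem_center_iff.1 (θ ⟨x, hx⟩).2 y]
        simp
      have hm : ((1 : G), (θ ⟨x, hx⟩ : H) * y)⁻¹ * (x, y)
          = (x, (((θ ⟨x, hx⟩)⁻¹ : Subgroup.center H) : H)) :=
        Prod.ext (by simp) hc
      rw [hm]
      exact ⟨Subtype.property ((θ ⟨x, hx⟩)⁻¹), hx, by simp⟩

end CentralProduct

/-- Groups with center of order two. Two such groups have exactly one isomorphism between their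
centers, so that their central product needs no further data. -/
structure TwoCenteredGroup where
  carrier : Type
  [group : Group carrier]
  card_center : Nat.card (Subgroup.center carrier) = 2

namespace TwoCenteredGroup

instance : CoeSort TwoCenteredGroup Type := ⟨carrier⟩

instance (G : TwoCenteredGroup) : Group G := G.group

/-- The isomorphism between two centers of order two. -/
noncomputable def centerEquiv (G H : TwoCenteredGroup) :
    Subgroup.center G ≃* Subgroup.center H :=
  haveI : Fact (Nat.Prime 2) := ⟨Nat.prime_two⟩
  mulEquivOfPrimeCardEq G.card_center H.card_center

/-- The central product `G ∘ H` of two groups with center of order two. -/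
noncomputable def centralProd (G H : TwoCenteredGroup) : TwoCenteredGroup where
  carrier := CentralProduct (centerEquiv G H)
  card_center := (card_center_centralProduct _).trans H.card_center

/-- The dihedral group `D₄` of order `8`. -/
def D4 : TwoCenteredGroup where
  carrier := DihedralGroup 4
  card_center := by
    rw [Nat.card_eq_fintype_card]
    decide

/-- The quaternion group `Q₂` of order `8`. -/
def Q2 : TwoCenteredGroup where
  carrier := QuaternionGroup 2
  card_center := by
    rw [Nat.card_eq_fintype_card]
    decide

/-- `G ∘ D₄ ∘ ⋯ ∘ D₄` with `k` copies of `D₄`. -/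
noncomputable def centralProdD4 (G : TwoCenteredGroup) : ℕ → TwoCenteredGroup
  | 0 => G
  | k + 1 => centralProd (centralProdD4 G k) D4

/-- `D₄^{(n)} = D₄ ∘ ⋯ ∘ D₄` with `n` copies of `D₄` (for `n ≥ 1`). -/
noncomputable def D4Power (n : ℕ) : TwoCenteredGroup := centralProdD4 D4 (n - 1)

/-- `Q₂D₄^{(m)} = Q₂ ∘ D₄ ∘ ⋯ ∘ D₄` with `m` copies of `D₄`. -/
noncomputable def Q2D4Power (m : ℕ) : TwoCenteredGroup := centralProdD4 Q2 m

end TwoCenteredGroup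

/-! ### Quadratic forms -/

/-- The quadratic map `q : V → W` over `𝔽₂` is, after identifying `G / Z(G)` with `V` and `Z(G)`
with `W`, the map `x Z(G) ↦ x²`. (Additive isomorphisms of `𝔽₂`-spaces are linear, so this says
that `q` is isometric to the quadratic map associated to `G`.) -/
def IsAssociatedQuadraticMap (G : Type*) [Group G] {V W : Type*} [AddCommGroup V]
    [Module (ZMod 2) V] [AddCommGroup W] [Module (ZMod 2) W]
    (q : QuadraticMap (ZMod 2) V W) : Prop :=
  ∃ (π : G ⧸ Subgroup.center G ≃* Multiplicative V) (ζ : Subgroup.center G ≃* Multiplicative W),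
    ∀ x : G, ∃ h : x ^ 2 ∈ Subgroup.center G,
      q (π (x : G ⧸ Subgroup.center G)).toAdd = (ζ ⟨x ^ 2, h⟩).toAdd

/-- The binary form `[a, b]`, that is `(x, y) ↦ a x² + x y + b y²`. -/
def binaryForm {K : Type*} [CommRing K] (a b : K) : QuadraticForm K (K × K) :=
  a • QuadraticMap.linMulLin (LinearMap.fst K K K) (LinearMap.fst K K K)
    + QuadraticMap.linMulLin (LinearMap.fst K K K) (LinearMap.snd K K K)
    + b • QuadraticMap.linMulLin (LinearMap.snd K K K) (LinearMap.snd K K K)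

theorem binaryForm_apply {K : Type*} [CommRing K] (a b x y : K) :
    binaryForm a b (x, y) = a * x ^ 2 + x * y + b * y ^ 2 := by
  simp [binaryForm, pow_two]

/-- `[0,0] ⊥ ⋯ ⊥ [0,0]` with `n` summands over `𝔽₂`. -/
def hyperbolicForm (n : ℕ) : QuadraticForm (ZMod 2) (Fin n → ZMod 2 × ZMod 2) :=
  QuadraticMap.pi fun _ => binaryForm 0 0

/-- `[1,1] ⊥ [0,0] ⊥ ⋯ ⊥ [0,0]` with `m` summands `[0,0]` over `𝔽₂`. -/
def ellipticForm (m : ℕ) :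
    QuadraticForm (ZMod 2) ((ZMod 2 × ZMod 2) × (Fin m → ZMod 2 × ZMod 2)) :=
  QuadraticMap.prod (binaryForm 1 1) (hyperbolicForm m)

/-! ### The Arf invariant -/

/-- `℘(K) = {x² + x : x ∈ K}` as a subgroup of the additive group of a field of
characteristic two. -/
def artinSchreier (K : Type*) [Field K] [CharP K 2] : AddSubgroup K where
  carrier := {c | ∃ x : K, c = x ^ 2 + x}
  zero_mem' := ⟨0, by simp⟩
  add_mem' := by
    rintro _ _ ⟨x, rfl⟩ ⟨y, rfl⟩
    exact ⟨x + y, by rw [CharTwo.add_sq]; ring⟩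
  neg_mem' := by
    rintro _ ⟨x, rfl⟩
    exact ⟨x, CharTwo.neg_eq _⟩

/-- A basis `e₁, …, eₙ, f₁, …, fₙ` (the `eᵢ` indexed by `Sum.inl`, the `fᵢ` by `Sum.inr`) that is
symplectic for the polar form of `q`. -/
def IsSymplecticBasis {K V : Type*} [Field K] [AddCommGroup V] [Module K V]
    (q : QuadraticForm K V) {n : ℕ} (b : Module.Basis (Fin n ⊕ Fin n) K V) : Prop :=
  ∀ i j : Fin n,
    QuadraticMap.polar q (b (Sum.inl i)) (b (Sum.inl j)) = 0 ∧
    QuadraticMap.polar q (b (Sum.inr i)) (b (Sum.inr j)) = 0 ∧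
    QuadraticMap.polar q (b (Sum.inl i)) (b (Sum.inr j)) = if i = j then 1 else 0

/-- `a ∈ K / ℘(K)` is the Arf invariant of `q`: symplectic bases exist, and for each of them `a` is
the class of `∑ q(eᵢ) q(fᵢ)`. -/
def HasArfInvariant {K V : Type*} [Field K] [CharP K 2] [AddCommGroup V] [Module K V]
    (q : QuadraticForm K V) (a : K ⧸ artinSchreier K) : Prop :=
  (∃ (n : ℕ) (b : Module.Basis (Fin n ⊕ Fin n) K V), IsSymplecticBasis q b) ∧
  ∀ (n : ℕ) (b : Module.Basis (Fin n ⊕ Fin n) K V), IsSymplecticBasis q b →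
    ((∑ i : Fin n, q (b (Sum.inl i)) * q (b (Sum.inr i)) : K) : K ⧸ artinSchreier K) = a

/-! In both families the center has order two and contains every square. Hence commutators are
central and G/Z(G) is an 𝔽₂-space. A noncommutative finite group of this kind is extraspecial
(`isExtraspecialTwoGroup_of_sq_mem_center`).

Squaring turns central products into orthogonal sums (`IsQuadraticModel.centralProd`), so the forms
follow from those of D₄ and Q₂. The Arf invariant is read off from the sign of the Gauss sum ∑
(-1)^q(v), which involves no basis (`IsSymplecticBasis.sum_signOfBit`). Strong reality holds because
every element of order four fails to commute with some involution, a D₄ factor supplying it.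

For representations, the central involution acts on an irreducible one by 1 or -1. If it acts by 1,
all operators are ±1. If it acts by -1, let a D₄ factor act through a rotation R and a reflection S:
then V = F ⊕ RF with F the fixed space of S, and the remaining factors act on F. This peels off one
D₄ at a time. For D₄^{(n)}, real bases of F lift to real bases of V, so everything is realizable
over ℝ. For Q₂D₄^{(k)}, real dimensions are halved at each step until a real representation of Q₂
with center acting by -1 remains, of dimension at least 4; so such real representations have
dimension at least 2^(k+2) (`le_finrank_of_signOnCenter`). Tensor products of two-dimensional
representations give a complex one of dimension only 2^(k+1), and no irreducible constituent of it
can be real. -/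

/-! ### Groups with center of order two and central squares -/

section CenterOfOrderTwo

variable {G : Type*} [Group G]

theorem eq_of_mem_center_of_ne_one (hc : Nat.card (Subgroup.center G) = 2) {a b : G}
    (ha : a ∈ Subgroup.center G) (hb : b ∈ Subgroup.center G) (ha1 : a ≠ 1) (hb1 : b ≠ 1) :
    a = b := by
  obtain ⟨x, y, -, hxy⟩ := Nat.card_eq_two_iff.1 hc
  have h : ∀ c : Subgroup.center G, c = x ∨ c = y := fun c => by
    have : c ∈ ({x, y} : Set (Subgroup.center G)) := hxy ▸ Set.mem_univ c
    simpa using this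
  have e : (⟨a, ha⟩ : Subgroup.center G) = ⟨b, hb⟩ := by
    have ha1' : (⟨a, ha⟩ : Subgroup.center G) ≠ 1 := fun h => ha1 (congrArg Subtype.val h)
    have hb1' : (⟨b, hb⟩ : Subgroup.center G) ≠ 1 := fun h => hb1 (congrArg Subtype.val h)
    rcases h 1 with h1 | h1 <;> rcases h ⟨a, ha⟩ with h2 | h2 <;> rcases h ⟨b, hb⟩ with h3 | h3 <;>
      simp_all
  exact congrArg Subtype.val e

theorem sq_eq_one_of_mem_center (hc : Nat.card (Subgroup.center G) = 2) {a : G}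
    (ha : a ∈ Subgroup.center G) : a ^ 2 = 1 := by
  have h := pow_card_eq_one' (x := (⟨a, ha⟩ : Subgroup.center G))
  rw [hc] at h
  exact congrArg Subtype.val h

theorem exists_mem_center_ne_one (hc : Nat.card (Subgroup.center G) = 2) :
    ∃ a ∈ Subgroup.center G, a ≠ 1 := by
  obtain ⟨x, y, hxy, -⟩ := Nat.card_eq_two_iff.1 hc
  by_cases hx : x = 1
  · exact ⟨y, y.2, fun h => hxy (hx.trans (Subtype.ext h.symm))⟩
  · exact ⟨x, x.2, fun h => hx (Subtype.ext h)⟩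

open scoped commutatorElement

/-- A commutator is a product of conjugates of squares. -/
theorem commutatorElement_mem_center (hsq : ∀ x : G, x ^ 2 ∈ Subgroup.center G) (x y : G) :
    ⁅x, y⁆ ∈ Subgroup.center G := by
  have h : ⁅x, y⁆ = (x * y) ^ 2 * (y⁻¹ * x⁻¹ ^ 2 * y⁻¹⁻¹) * y⁻¹ ^ 2 := by
    rw [commutatorElement_def, pow_two (x * y)]; group
  rw [h]
  exact mul_mem (mul_mem (hsq _) ((inferInstance : (Subgroup.center G).Normal).conj_mem _ (hsq _) _))
    (hsq _)

/-- If x does not commute with y, then x lies outside the centralizer of y. That centralizer is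
maximal: ⁅·, y⁆ has a single nontrivial value, so any two elements outside it differ by an element
of it. -/
theorem frattini_le_center (hc : Nat.card (Subgroup.center G) = 2)
    (hsq : ∀ x : G, x ^ 2 ∈ Subgroup.center G) : frattini G ≤ Subgroup.center G := by
  intro x hx
  rw [Subgroup.mem_center_iff]
  by_contra! hxy
  obtain ⟨y, hxy⟩ := hxy
  have hM : IsCoatom (Subgroup.centralizer {y} : Subgroup G) := by
    refine ⟨fun h => hxy ?_, fun K hK => ?_⟩
    · exact Subgroup.mem_centralizer_singleton_iff.1 (h ▸ Subgroup.mem_top x) |>.symm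
    · obtain ⟨hle, hne⟩ := SetLike.lt_iff_le_and_exists.1 hK
      obtain ⟨k, hk, hky⟩ := hne
      refine eq_top_iff.2 fun g _ => ?_
      by_cases hg : g ∈ Subgroup.centralizer {y}
      · exact hle hg
      have key : ∀ a, a ∉ Subgroup.centralizer {y} → ⁅a, y⁆ ≠ 1 := fun a ha h =>
        ha (Subgroup.mem_centralizer_singleton_iff.2 (commutatorElement_eq_one_iff_mul_comm.1 h))
      have e := eq_of_mem_center_of_ne_one hc (commutatorElement_mem_center hsq g y)
        (commutatorElement_mem_center hsq k y) (key g hg) (key k hky)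
      have e' : g * y * g⁻¹ = k * y * k⁻¹ := mul_right_cancel e
      have : k⁻¹ * g ∈ Subgroup.centralizer {y} := by
        rw [Subgroup.mem_centralizer_singleton_iff]
        calc k⁻¹ * g * y = k⁻¹ * (g * y * g⁻¹) * g := by group
          _ = k⁻¹ * (k * y * k⁻¹) * g := by rw [e']
          _ = y * (k⁻¹ * g) := by group
      have h2 := mul_mem hk (hle this)
      rwa [mul_inv_cancel_left] at h2
  exact hxy (Subgroup.mem_centralizer_singleton_iff.1 (frattini_le_coatom hM hx)).symm

/-- Here G = M Z(G), and central factors cancel in commutators, so [G,G] = [M,M]. Once [G,G] = Z(G),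
this forces every maximal subgroup to contain the center. -/
theorem commutator_le_of_isCoatom_of_not_center_le {M : Subgroup G} (hM : IsCoatom M)
    (h : ¬ Subgroup.center G ≤ M) : commutator G ≤ M := by
  have htop : M ⊔ Subgroup.center G = ⊤ :=
    hM.2 _ (lt_of_le_of_ne le_sup_left fun e => h (e ▸ le_sup_right))
  have hdec : ∀ x : G, ∃ m ∈ M, ∃ z ∈ Subgroup.center G, m * z = x := fun x =>
    Subgroup.mem_sup_of_normal_right.1 (htop ▸ Subgroup.mem_top x)
  rw [commutator_def, Subgroup.commutator_le]
  intro x _ y _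
  obtain ⟨m, hm, z, hz, rfl⟩ := hdec x
  obtain ⟨m', hm', z', hz', rfl⟩ := hdec y
  have hz1 := Subgroup.mem_center_iff.1 hz
  have hz2 := Subgroup.mem_center_iff.1 hz'
  have : ⁅m * z, m' * z'⁆ = ⁅m, m'⁆ := by
    rw [commutatorElement_def, commutatorElement_def]
    calc m * z * (m' * z') * (m * z)⁻¹ * (m' * z')⁻¹
        = m * (z * (m' * z')) * z⁻¹ * m⁻¹ * z'⁻¹ * m'⁻¹ := by group
      _ = m * (m' * z' * m⁻¹) * z'⁻¹ * m'⁻¹ := by rw [← hz1]; group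
      _ = m * m' * m⁻¹ * m'⁻¹ := by
        rw [mul_assoc m' z', ← hz2 m⁻¹]; group
  rw [this]
  exact mul_mem (mul_mem (mul_mem hm hm') (inv_mem hm)) (inv_mem hm')

theorem isExtraspecialTwoGroup_of_sq_mem_center [Finite G]
    (hc : Nat.card (Subgroup.center G) = 2) (hsq : ∀ x : G, x ^ 2 ∈ Subgroup.center G)
    (hne : ∃ x y : G, x * y ≠ y * x) : IsExtraspecialTwoGroup G := by
  have hcomm : commutator G = Subgroup.center G := by
    refine le_antisymm ?_ fun z hz => ?_
    · rw [commutator_def, Subgroup.commutator_le]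
      exact fun x _ y _ => commutatorElement_mem_center hsq x y
    · by_cases h1 : z = 1
      · exact h1 ▸ one_mem _
      obtain ⟨x, y, hxy⟩ := hne
      rw [eq_of_mem_center_of_ne_one hc hz (commutatorElement_mem_center hsq x y) h1
        fun h => hxy (commutatorElement_eq_one_iff_mul_comm.1 h)]
      exact Subgroup.commutator_mem_commutator (Subgroup.mem_top x) (Subgroup.mem_top y)
  refine ⟨⟨inferInstance, fun x => ⟨2, ?_⟩, hne, hcomm, ?_, ?_⟩, hc⟩
  · change x ^ (2 * 2) = 1
    rw [pow_mul]
    exact sq_eq_one_of_mem_center hc (hsq x)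
  · refine le_antisymm (frattini_le_center hc hsq) ?_
    rw [frattini, Order.radical]
    refine le_iInf₂ fun M hM => ?_
    by_contra h
    exact h (hcomm ▸ commutator_le_of_isCoatom_of_not_center_le hM h)
  · refine le_antisymm ((Subgroup.closure_le _).2 fun x hx => hx.1) fun x hx =>
      Subgroup.subset_closure ⟨hx, sq_eq_one_of_mem_center hc hx⟩

theorem IsStronglyReal.isRealGroup (h : IsStronglyReal G) : IsRealGroup G := by
  intro x
  obtain ⟨y, z, hy, hz, rfl⟩ := h x
  rw [isConj_iff]
  refine ⟨y, ?_⟩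
  rw [pow_two, ← eq_inv_iff_mul_eq_one] at hy hz
  calc y * (y * z) * y⁻¹ = y * y * z * y⁻¹ := by group
    _ = z * y⁻¹ := by nth_rewrite 1 [hy]; group
    _ = (y * z)⁻¹ := by rw [mul_inv_rev, ← hz]

/-- Write x = (xy)y. If (xy)² were nontrivial it would equal x², the only nontrivial central
element; cancelling x gives yxy = x, against the choice of y. -/
theorem isStronglyReal_of_exists_involution (hc : Nat.card (Subgroup.center G) = 2)
    (hsq : ∀ x : G, x ^ 2 ∈ Subgroup.center G)
    (h : ∀ x : G, x ^ 2 ≠ 1 → ∃ y : G, y ^ 2 = 1 ∧ x * y ≠ y * x) : IsStronglyReal G := by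
  intro x
  by_cases hx : x ^ 2 = 1
  · exact ⟨x, 1, hx, one_pow 2, (mul_one x).symm⟩
  obtain ⟨y, hy, hxy⟩ := h x hx
  refine ⟨x * y, y, ?_, hy, by rw [mul_assoc, ← pow_two, hy, mul_one]⟩
  by_contra hxy2
  have e := eq_of_mem_center_of_ne_one hc (hsq _) (hsq _) hxy2 hx
  rw [pow_two, pow_two, mul_assoc] at e
  have e2 := mul_left_cancel e
  apply hxy
  nth_rewrite 1 [← e2]
  rw [mul_assoc, mul_assoc, ← pow_two, hy, mul_one]

end CenterOfOrderTwo

/-! ### Central products: kernel, center and strong reality -/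

namespace TwoCenteredGroup

open scoped commutatorElement

/-- The kernel consists of (1,1) and the pair of nontrivial central elements, a description that no
longer mentions θ. -/
theorem mem_centralKernel_iff (G H : TwoCenteredGroup) (p : G × H) :
    p ∈ centralKernel (centerEquiv G H) ↔
      p.1 ∈ Subgroup.center G ∧ p.2 ∈ Subgroup.center H ∧ (p.1 = 1 ↔ p.2 = 1) := by
  have key : ∀ h : p.1 ∈ Subgroup.center G,
      ((centerEquiv G H ⟨p.1, h⟩ : H) = 1 ↔ p.1 = 1) := fun h => by
    rw [OneMemClass.coe_eq_one, map_eq_one_iff _ (centerEquiv G H).injective]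
    exact ⟨fun e => congrArg Subtype.val e, fun e => Subtype.ext e⟩
  constructor
  · rintro ⟨hb, ha, h⟩
    refine ⟨ha, hb, ?_⟩
    rw [← key ha]
    constructor
    · intro h1; rwa [h1, one_mul] at h
    · intro h1; rwa [h1, mul_one] at h
  · rintro ⟨ha, hb, h⟩
    refine ⟨hb, ha, ?_⟩
    rw [← key ha] at h
    by_cases h1 : p.2 = 1
    · rw [h.2 h1, h1, mul_one]
    · rw [eq_of_mem_center_of_ne_one H.card_center (Subtype.property _) hb (fun e => h1 (h.1 e)) h1,
        ← pow_two]
      exact sq_eq_one_of_mem_center H.card_center hb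

/-- The projection of the product of two groups onto their central product. -/
noncomputable def centralProdMk (G H : TwoCenteredGroup) : G × H →* centralProd G H :=
  QuotientGroup.mk' (centralKernel (centerEquiv G H))

variable {G H : TwoCenteredGroup}

theorem centralProdMk_surjective : Function.Surjective (centralProdMk G H) :=
  QuotientGroup.mk'_surjective _

theorem centralProdMk_eq_one_iff {p : G × H} : centralProdMk G H p = 1 ↔
    p.1 ∈ Subgroup.center G ∧ p.2 ∈ Subgroup.center H ∧ (p.1 = 1 ↔ p.2 = 1) := by
  rw [← mem_centralKernel_iff]
  exact QuotientGroup.eq_one_iff _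

instance [Finite G] [Finite H] : Finite (centralProd G H) :=
  Finite.of_surjective _ centralProdMk_surjective

theorem centralProdMk_commute_iff {p p' : G × H} :
    centralProdMk G H p * centralProdMk G H p' = centralProdMk G H p' * centralProdMk G H p ↔
      centralProdMk G H (⁅p.1, p'.1⁆, ⁅p.2, p'.2⁆) = 1 := by
  rw [← commutatorElement_eq_one_iff_mul_comm, ← map_commutatorElement]
  rfl

theorem mem_center_of_centralProdMk_mem_center {p : G × H}
    (h : centralProdMk G H p ∈ Subgroup.center (centralProd G H)) :
    p.1 ∈ Subgroup.center G ∧ p.2 ∈ Subgroup.center H := by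
  rw [Subgroup.mem_center_iff] at h
  constructor
  · rw [Subgroup.mem_center_iff]
    intro g
    have := centralProdMk_commute_iff.1 (h (centralProdMk G H (g, 1)))
    rw [centralProdMk_eq_one_iff] at this
    simpa [commutatorElement_eq_one_iff_mul_comm] using this.2.2
  · rw [Subgroup.mem_center_iff]
    intro g
    have := centralProdMk_commute_iff.1 (h (centralProdMk G H (1, g)))
    rw [centralProdMk_eq_one_iff] at this
    simpa [commutatorElement_eq_one_iff_mul_comm] using this.2.2

theorem centralProdMk_mem_center {p : G × H} (h1 : p.1 ∈ Subgroup.center G)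
    (h2 : p.2 ∈ Subgroup.center H) :
    centralProdMk G H p ∈ Subgroup.center (centralProd G H) := by
  rw [Subgroup.mem_center_iff] at *
  intro x
  obtain ⟨p', rfl⟩ := centralProdMk_surjective x
  rw [← map_mul, ← map_mul]
  exact congrArg _ (Prod.ext (h1 _) (h2 _))

theorem centralProd_sq_mem_center (hG : ∀ x : G, x ^ 2 ∈ Subgroup.center G)
    (hH : ∀ x : H, x ^ 2 ∈ Subgroup.center H) (x : centralProd G H) :
    x ^ 2 ∈ Subgroup.center (centralProd G H) := by
  obtain ⟨p, rfl⟩ := centralProdMk_surjective x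
  rw [← map_pow]
  exact centralProdMk_mem_center (hG _) (hH _)

theorem D4_sq_mem_center (x : D4) : x ^ 2 ∈ Subgroup.center D4 := by
  have : ∀ x g : DihedralGroup 4, g * x ^ 2 = x ^ 2 * g := by decide
  exact Subgroup.mem_center_iff.2 (this x)

theorem Q2_sq_mem_center (x : Q2) : x ^ 2 ∈ Subgroup.center Q2 := by
  have : ∀ x g : QuaternionGroup 2, g * x ^ 2 = x ^ 2 * g := by decide
  exact Subgroup.mem_center_iff.2 (this x)

instance : Finite D4 := inferInstanceAs (Finite (DihedralGroup 4))

instance : Finite Q2 := inferInstanceAs (Finite (QuaternionGroup 2))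

instance finite_centralProdD4 (G : TwoCenteredGroup) [Finite G] : ∀ k, Finite (centralProdD4 G k)
  | 0 => inferInstanceAs (Finite G)
  | k + 1 =>
    haveI := finite_centralProdD4 G k
    inferInstanceAs (Finite (centralProd (centralProdD4 G k) D4))

theorem centralProdD4_sq_mem_center (hG : ∀ x : G, x ^ 2 ∈ Subgroup.center G) :
    ∀ k, ∀ x : centralProdD4 G k, x ^ 2 ∈ Subgroup.center (centralProdD4 G k)
  | 0 => hG
  | k + 1 => centralProd_sq_mem_center (centralProdD4_sq_mem_center hG k) D4_sq_mem_center

theorem centralProd_not_comm (hH : ∃ x y : H, x * y ≠ y * x) :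
    ∃ x y : centralProd G H, x * y ≠ y * x := by
  obtain ⟨x, y, h⟩ := hH
  refine ⟨centralProdMk G H (1, x), centralProdMk G H (1, y), fun e => h ?_⟩
  rw [centralProdMk_commute_iff, centralProdMk_eq_one_iff] at e
  simpa [commutatorElement_eq_one_iff_mul_comm] using e.2.2

theorem D4_not_comm : ∃ x y : D4, x * y ≠ y * x := by
  have : ∃ x y : DihedralGroup 4, x * y ≠ y * x := by decide
  exact this

theorem centralProdD4_isExtraspecial [Finite G] (hG : ∀ x : G, x ^ 2 ∈ Subgroup.center G)
    (hne : ∃ x y : G, x * y ≠ y * x) (k : ℕ) : IsExtraspecialTwoGroup (centralProdD4 G k) := by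
  refine isExtraspecialTwoGroup_of_sq_mem_center (card_center _)
    (centralProdD4_sq_mem_center hG k) ?_
  cases k with
  | zero => exact hne
  | succ k => exact centralProd_not_comm D4_not_comm

theorem D4_isStronglyReal : IsStronglyReal D4 := by
  have : ∀ x : DihedralGroup 4, ∃ y z : DihedralGroup 4, y ^ 2 = 1 ∧ z ^ 2 = 1 ∧ x = y * z := by
    decide
  exact this

/-- Strong reality of G is not needed, so this covers G = Q₂. An involution that does not commute
with (g, d) comes from D₄ if d is noncentral, and from some g' not commuting with g otherwise. -/
theorem centralProd_D4_isStronglyReal (hG : ∀ x : G, x ^ 2 ∈ Subgroup.center G) :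
    IsStronglyReal (centralProd G D4) := by
  refine isStronglyReal_of_exists_involution (card_center _)
    (centralProd_sq_mem_center hG D4_sq_mem_center) fun x hx => ?_
  obtain ⟨⟨g, d⟩, rfl⟩ := centralProdMk_surjective x
  by_cases hd : d ∈ Subgroup.center D4
  · have hg : g ∉ Subgroup.center G := fun hg =>
      hx (sq_eq_one_of_mem_center (card_center _) (centralProdMk_mem_center hg hd))
    rw [Subgroup.mem_center_iff] at hg
    push Not at hg
    obtain ⟨g', hg'⟩ := hg
    have key : ∀ d' : D4, centralProdMk G D4 (g, d) * centralProdMk G D4 (g', d')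
        ≠ centralProdMk G D4 (g', d') * centralProdMk G D4 (g, d) := fun d' h => by
      rw [centralProdMk_commute_iff, centralProdMk_eq_one_iff] at h
      have h2 : ⁅d, d'⁆ = 1 :=
        commutatorElement_eq_one_iff_mul_comm.2 (Subgroup.mem_center_iff.1 hd d').symm
      exact hg' (commutatorElement_eq_one_iff_mul_comm.1 (h.2.2.2 h2)).symm
    by_cases h1 : g' ^ 2 = 1
    · refine ⟨centralProdMk G D4 (g', 1), ?_, key 1⟩
      rw [← map_pow, centralProdMk_eq_one_iff]
      simp [h1]
    -- When g' has order four, pairing it with a rotation of order four makes the two nontrivial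
    -- squares cancel in the central product.
    · have hr : ((DihedralGroup.r 1 : DihedralGroup 4) ^ 2) ≠ 1 := by decide
      refine ⟨centralProdMk G D4 (g', (DihedralGroup.r 1 : DihedralGroup 4)), ?_, key _⟩
      rw [← map_pow, centralProdMk_eq_one_iff]
      exact ⟨hG _, D4_sq_mem_center _, iff_of_false h1 hr⟩
  · have : ∀ d : DihedralGroup 4, (∃ g, g * d ≠ d * g) → ∃ s, s ^ 2 = 1 ∧ d * s ≠ s * d := by
      decide
    rw [Subgroup.mem_center_iff] at hd
    push Not at hd
    obtain ⟨s, hs, hds⟩ := this d hd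
    refine ⟨centralProdMk G D4 (1, s), ?_, fun h => hds ?_⟩
    · rw [← map_pow]
      exact (congrArg (centralProdMk G D4) (Prod.ext (one_pow 2) hs)).trans (map_one _)
    · rw [centralProdMk_commute_iff, centralProdMk_eq_one_iff] at h
      exact commutatorElement_eq_one_iff_mul_comm.1
        (h.2.2.1 (commutatorElement_one_right g))

end TwoCenteredGroup

/-! ### The squaring form and orthogonal sums -/

section QuadraticModel

variable {V W : Type*} [AddCommGroup V] [Module (ZMod 2) V] [AddCommGroup W] [Module (ZMod 2) W]

/-- `f` presents `V` as `G / Z(G)`, in such a way that `q` vanishes exactly on the classes of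
elements of square one. -/
structure IsQuadraticModel {G : Type*} [Group G] (q : QuadraticForm (ZMod 2) V)
    (f : G →* Multiplicative V) : Prop where
  surjective : Function.Surjective f
  ker_eq : f.ker = Subgroup.center G
  sq_eq_one_iff : ∀ x, x ^ 2 = 1 ↔ q (f x).toAdd = 0

theorem ZMod.eq_zero_iff_iff_eq {a b : ZMod 2} : (a = 0 ↔ b = 0) ↔ a = b := by
  revert a b; decide

theorem IsQuadraticModel.sq_mem_center {G : Type*} [Group G] {q : QuadraticForm (ZMod 2) V}
    {f : G →* Multiplicative V} (h : IsQuadraticModel q f) (x : G) :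
    x ^ 2 ∈ Subgroup.center G := by
  rw [← h.ker_eq, MonoidHom.mem_ker, map_pow]
  apply Multiplicative.toAdd.injective
  rw [toAdd_pow, toAdd_one, ← Nat.cast_smul_eq_nsmul (ZMod 2)]
  exact zero_smul _ _

/-- Both q and the squaring map take values in a group of order two, so agreeing on where they are
trivial is enough. -/
theorem IsQuadraticModel.isAssociatedQuadraticMap {G : Type*} [Group G]
    {q : QuadraticForm (ZMod 2) V} {f : G →* Multiplicative V} (h : IsQuadraticModel q f)
    (hc : Nat.card (Subgroup.center G) = 2) : IsAssociatedQuadraticMap G q := by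
  have : Fact (Nat.Prime 2) := ⟨Nat.prime_two⟩
  let ζ : Subgroup.center G ≃* Multiplicative (ZMod 2) :=
    mulEquivOfPrimeCardEq hc (by simp)
  let π : G ⧸ Subgroup.center G ≃* Multiplicative V :=
    (QuotientGroup.quotientMulEquivOfEq h.ker_eq.symm).trans
      (QuotientGroup.quotientKerEquivOfSurjective f h.surjective)
  refine ⟨π, ζ, fun x => ?_⟩
  refine ⟨h.sq_mem_center x, ?_⟩
  have hπ : π (x : G ⧸ Subgroup.center G) = f x := rfl
  rw [hπ, ← ZMod.eq_zero_iff_iff_eq, ← h.sq_eq_one_iff, ← toAdd_one,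
    Multiplicative.toAdd.apply_eq_iff_eq, map_eq_one_iff ζ ζ.injective]
  exact ⟨fun e => Subtype.ext e, fun e => congrArg Subtype.val e⟩

theorem IsQuadraticModel.of_equiv {G : Type*} [Group G]
    {q : QuadraticForm (ZMod 2) V} {f : G →* Multiplicative V} (h : IsQuadraticModel q f)
    {q' : QuadraticForm (ZMod 2) W} (e : q.IsometryEquiv q') :
    ∃ f' : G →* Multiplicative W, IsQuadraticModel q' f' := by
  let e' : Multiplicative V ≃* Multiplicative W :=
    AddEquiv.toMultiplicative e.toLinearEquiv.toAddEquiv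
  refine ⟨e'.toMonoidHom.comp f, e'.surjective.comp h.surjective, ?_, fun x => ?_⟩
  · rw [← h.ker_eq]
    ext x
    exact map_eq_one_iff e' e'.injective
  · rw [h.sq_eq_one_iff, ← e.map_app]
    rfl

/-- The square of (x, y) dies in the central product iff x² and y² are both trivial or both
nontrivial, i.e. iff q + q' = 0 over 𝔽₂. -/
theorem IsQuadraticModel.centralProd {G H : TwoCenteredGroup}
    {q : QuadraticForm (ZMod 2) V} {f : G →* Multiplicative V} (h : IsQuadraticModel q f)
    {q' : QuadraticForm (ZMod 2) W} {f' : H →* Multiplicative W} (h' : IsQuadraticModel q' f') :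
    ∃ F : G.centralProd H →* Multiplicative (V × W), IsQuadraticModel (q.prod q') F := by
  let F₀ : G × H →* Multiplicative (V × W) :=
    { toFun p := Multiplicative.ofAdd ((f p.1).toAdd, (f' p.2).toAdd)
      map_one' := by simp
      map_mul' p p' := by simp; rfl }
  have hF₀ : ∀ p, F₀ p = 1 ↔ p.1 ∈ Subgroup.center G ∧ p.2 ∈ Subgroup.center H := fun p => by
    rw [← h.ker_eq, ← h'.ker_eq]
    exact Prod.mk_eq_zero
  have hle : centralKernel (TwoCenteredGroup.centerEquiv G H) ≤ F₀.ker := fun p hp => by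
    rw [TwoCenteredGroup.mem_centralKernel_iff] at hp
    exact (hF₀ p).2 ⟨hp.1, hp.2.1⟩
  let F : G.centralProd H →* Multiplicative (V × W) := QuotientGroup.lift _ F₀ hle
  have hF : ∀ p, F (TwoCenteredGroup.centralProdMk G H p) = F₀ p := fun p => rfl
  refine ⟨F, ?_, ?_, fun x => ?_⟩
  · intro v
    obtain ⟨x, hx⟩ := h.surjective (Multiplicative.ofAdd v.toAdd.1)
    obtain ⟨y, hy⟩ := h'.surjective (Multiplicative.ofAdd v.toAdd.2)
    refine ⟨TwoCenteredGroup.centralProdMk G H (x, y), ?_⟩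
    rw [hF]
    change Multiplicative.ofAdd ((f x).toAdd, (f' y).toAdd) = v
    rw [hx, hy]
    rfl
  · ext x
    obtain ⟨p, rfl⟩ := TwoCenteredGroup.centralProdMk_surjective x
    rw [MonoidHom.mem_ker, hF, hF₀]
    exact ⟨fun h => TwoCenteredGroup.centralProdMk_mem_center h.1 h.2,
      TwoCenteredGroup.mem_center_of_centralProdMk_mem_center⟩
  · obtain ⟨p, rfl⟩ := TwoCenteredGroup.centralProdMk_surjective x
    rw [hF, ← map_pow, TwoCenteredGroup.centralProdMk_eq_one_iff]
    change _ ↔ q (f p.1).toAdd + q' (f' p.2).toAdd = 0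
    rw [CharTwo.add_eq_zero, ← ZMod.eq_zero_iff_iff_eq, ← h.sq_eq_one_iff, ← h'.sq_eq_one_iff]
    exact ⟨fun e => e.2.2, fun e => ⟨h.sq_mem_center _, h'.sq_mem_center _, e⟩⟩

/-- `[0,0] ⊥ ⋯ ⊥ [0,0]` is built up one summand at a time. -/
def hyperbolicFormSucc (n : ℕ) :
    ((hyperbolicForm n).prod (binaryForm (0 : ZMod 2) 0)).IsometryEquiv
      (hyperbolicForm (n + 1)) where
  toFun v := Fin.snoc (α := fun _ => ZMod 2 × ZMod 2) v.1 v.2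
  invFun w := (fun i => w i.castSucc, w (Fin.last n))
  left_inv v := by simp
  right_inv w := by
    ext i : 1
    refine Fin.lastCases ?_ (fun i => ?_) i <;> simp
  map_add' v w := by
    ext i : 1
    refine Fin.lastCases ?_ (fun i => ?_) i <;> simp
  map_smul' a v := by
    ext i : 1
    refine Fin.lastCases ?_ (fun i => ?_) i <;> simp
  map_app' v := by
    simp [hyperbolicForm, Fin.sum_univ_castSucc]

def hyperbolicFormOne : (binaryForm (0 : ZMod 2) 0).IsometryEquiv (hyperbolicForm 1) where
  toFun v := fun _ => v
  invFun w := w 0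
  left_inv v := rfl
  right_inv w := by
    ext i : 1
    rw [Subsingleton.elim i 0]
  map_add' v w := rfl
  map_smul' a v := rfl
  map_app' v := by simp [hyperbolicForm]

def quadraticProdAssoc {V₁ V₂ V₃ : Type*} [AddCommGroup V₁] [Module (ZMod 2) V₁] [AddCommGroup V₂]
    [Module (ZMod 2) V₂] [AddCommGroup V₃] [Module (ZMod 2) V₃] (q₁ : QuadraticForm (ZMod 2) V₁)
    (q₂ : QuadraticForm (ZMod 2) V₂) (q₃ : QuadraticForm (ZMod 2) V₃) :
    ((QuadraticMap.prod q₁ q₂).prod q₃).IsometryEquiv (q₁.prod (q₂.prod q₃)) where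
  __ := LinearEquiv.prodAssoc (ZMod 2) V₁ V₂ V₃
  map_app' v := by simp [add_assoc]

def ellipticFormZero : (binaryForm (1 : ZMod 2) 1).IsometryEquiv (ellipticForm 0) where
  toFun v := (v, 0)
  invFun w := w.1
  left_inv v := rfl
  right_inv w := Prod.ext rfl (Subsingleton.elim _ _)
  map_add' v w := by simp
  map_smul' a v := by simp
  map_app' v := by
    rw [ellipticForm, QuadraticMap.prod_apply, QuadraticMap.map_zero, add_zero]

def ellipticFormSucc (n : ℕ) :
    ((ellipticForm n).prod (binaryForm (0 : ZMod 2) 0)).IsometryEquiv (ellipticForm (n + 1)) :=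
  (quadraticProdAssoc _ _ _).trans ((QuadraticMap.IsometryEquiv.refl _).prod (hyperbolicFormSucc n))

end QuadraticModel

/-! ### Coordinates on D₄ and Q₂ modulo their centers -/

namespace TwoCenteredGroup

/-- The two classes of noncentral reflections go to (1,0) and (0,1), the zeros of xy, and the
rotations of order four to (1,1). -/
def D4Coordinates : DihedralGroup 4 → ZMod 2 × ZMod 2
  | .r i => ((i.val : ZMod 2), (i.val : ZMod 2))
  | .sr i => ((i.val : ZMod 2), (i.val : ZMod 2) + 1)

theorem exists_isQuadraticModel_D4 : ∃ f : D4 →* Multiplicative (ZMod 2 × ZMod 2),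
    IsQuadraticModel (binaryForm 0 0) f := by
  have hmul : ∀ x y : DihedralGroup 4,
    D4Coordinates (x * y) = D4Coordinates x + D4Coordinates y := by decide
  have hsurj : ∀ v, ∃ x, D4Coordinates x = v := by decide
  have hker : ∀ x, D4Coordinates x = 0 ↔ ∀ g, g * x = x * g := by decide
  have hsq : ∀ x, x ^ 2 = 1 ↔ (D4Coordinates x).1 * (D4Coordinates x).2 = 0 := by decide
  refine ⟨(⟨⟨fun x => Multiplicative.ofAdd (D4Coordinates x), rfl⟩,
    fun x y => congrArg Multiplicative.ofAdd (hmul x y)⟩ :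
    DihedralGroup 4 →* Multiplicative (ZMod 2 × ZMod 2)), fun v => ?_, ?_, fun x => ?_⟩
  · exact hsurj v.toAdd
  · ext x
    exact (hker x).trans Subgroup.mem_center_iff.symm
  · refine (hsq x).trans ?_
    have := binaryForm_apply (0 : ZMod 2) 0 (D4Coordinates x).1 (D4Coordinates x).2
    rw [zero_mul, zero_mul, zero_add, add_zero] at this
    rw [← this]
    rfl

def Q2Coordinates : QuaternionGroup 2 → ZMod 2 × ZMod 2
  | .a i => ((i.val : ZMod 2), 0)
  | .xa i => ((i.val : ZMod 2), 1)

theorem exists_isQuadraticModel_Q2 : ∃ f : Q2 →* Multiplicative (ZMod 2 × ZMod 2),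
    IsQuadraticModel (binaryForm 1 1) f := by
  have hmul : ∀ x y : QuaternionGroup 2,
    Q2Coordinates (x * y) = Q2Coordinates x + Q2Coordinates y := by decide
  have hsurj : ∀ v, ∃ x, Q2Coordinates x = v := by decide
  have hker : ∀ x, Q2Coordinates x = 0 ↔ ∀ g, g * x = x * g := by decide
  have hsq : ∀ x, x ^ 2 = 1 ↔ 1 * (Q2Coordinates x).1 ^ 2 +
    (Q2Coordinates x).1 * (Q2Coordinates x).2 + 1 * (Q2Coordinates x).2 ^ 2 = 0 := by decide
  refine ⟨(⟨⟨fun x => Multiplicative.ofAdd (Q2Coordinates x), rfl⟩,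
    fun x y => congrArg Multiplicative.ofAdd (hmul x y)⟩ :
    QuaternionGroup 2 →* Multiplicative (ZMod 2 × ZMod 2)), fun v => ?_, ?_, fun x => ?_⟩
  · exact hsurj v.toAdd
  · ext x
    exact (hker x).trans Subgroup.mem_center_iff.symm
  · refine (hsq x).trans ?_
    rw [← binaryForm_apply]
    rfl

theorem exists_isQuadraticModel_D4Power :
    ∀ k, ∃ f : centralProdD4 D4 k →* Multiplicative (Fin (k + 1) → ZMod 2 × ZMod 2),
      IsQuadraticModel (hyperbolicForm (k + 1)) f
  | 0 => by
    obtain ⟨f, hf⟩ := exists_isQuadraticModel_D4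
    exact hf.of_equiv hyperbolicFormOne
  | k + 1 => by
    obtain ⟨f, hf⟩ := exists_isQuadraticModel_D4Power k
    obtain ⟨f', hf'⟩ := exists_isQuadraticModel_D4
    obtain ⟨F, hF⟩ := hf.centralProd hf'
    exact hF.of_equiv (hyperbolicFormSucc (k + 1))

theorem exists_isQuadraticModel_Q2D4Power :
    ∀ k, ∃ f : centralProdD4 Q2 k →* Multiplicative ((ZMod 2 × ZMod 2) × (Fin k → ZMod 2 × ZMod 2)),
      IsQuadraticModel (ellipticForm k) f
  | 0 => by
    obtain ⟨f, hf⟩ := exists_isQuadraticModel_Q2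
    exact hf.of_equiv ellipticFormZero
  | k + 1 => by
    obtain ⟨f, hf⟩ := exists_isQuadraticModel_Q2D4Power k
    obtain ⟨f', hf'⟩ := exists_isQuadraticModel_D4
    obtain ⟨F, hF⟩ := hf.centralProd hf'
    exact hF.of_equiv (ellipticFormSucc k)

end TwoCenteredGroup

/-! ### The Arf invariant through Gauss sums -/

section Arf

open Finset

theorem artinSchreier_zmod_two : artinSchreier (ZMod 2) = ⊥ := by
  refine (AddSubgroup.eq_bot_iff_forall _).2 ?_
  rintro _ ⟨x, rfl⟩
  revert x; decide

/-- The nontrivial additive character of `𝔽₂`. -/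
def signOfBit (a : ZMod 2) : ℤ := if a = 0 then 1 else -1

theorem signOfBit_add (a b : ZMod 2) : signOfBit (a + b) = signOfBit a * signOfBit b := by
  revert a b; decide

theorem signOfBit_sum {ι : Type*} (s : Finset ι) (f : ι → ZMod 2) :
    signOfBit (∑ i ∈ s, f i) = ∏ i ∈ s, signOfBit (f i) := by
  classical
  induction s using Finset.induction_on with
  | empty => simp [signOfBit]
  | insert a s ha ih => rw [sum_insert ha, prod_insert ha, signOfBit_add, ih]

/-- Among four vectors, [a,b] takes the value 1 three times if a = b = 1 and once otherwise. -/
theorem sum_signOfBit_binaryForm (a b : ZMod 2) :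
    ∑ v : ZMod 2 × ZMod 2, signOfBit (binaryForm a b v) = 2 * signOfBit (a * b) := by
  have h : ∀ v : ZMod 2 × ZMod 2, binaryForm a b v = a * v.1 ^ 2 + v.1 * v.2 + b * v.2 ^ 2 :=
    fun v => binaryForm_apply a b v.1 v.2
  simp_rw [h]
  revert a b; decide

variable {K V : Type*} [Field K] [AddCommGroup V] [Module K V]

theorem map_sum_of_polar_eq_zero {ι : Type*} (q : QuadraticForm K V) (s : Finset ι) (w : ι → V)
    (h : ∀ i j, i ≠ j → QuadraticMap.polar q (w i) (w j) = 0) :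
    q (∑ i ∈ s, w i) = ∑ i ∈ s, q (w i) := by
  classical
  induction s using Finset.induction_on with
  | empty => simp
  | insert a s ha ih =>
    have hp : QuadraticMap.polarBilin q (w a) (∑ i ∈ s, w i) = 0 := by
      rw [map_sum]
      exact sum_eq_zero fun i hi => h a i fun e => ha (e ▸ hi)
    rw [QuadraticMap.polarBilin_apply_apply] at hp
    rw [sum_insert ha, sum_insert ha, QuadraticMap.map_add q, ih, hp, add_zero]

/-- A symplectic basis splits q orthogonally into the planes ⟨eᵢ, fᵢ⟩, carrying the forms [q(eᵢ),
q(fᵢ)]. -/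
theorem IsSymplecticBasis.map_equivFun_symm {q : QuadraticForm K V} {n : ℕ}
    {b : Module.Basis (Fin n ⊕ Fin n) K V} (hb : IsSymplecticBasis q b) (x : Fin n ⊕ Fin n → K) :
    q (b.equivFun.symm x) = ∑ i, binaryForm (q (b (.inl i))) (q (b (.inr i)))
      (x (.inl i), x (.inr i)) := by
  rw [Module.Basis.equivFun_symm_apply, Fintype.sum_sum_type, ← sum_add_distrib,
    map_sum_of_polar_eq_zero]
  · refine sum_congr rfl fun i _ => ?_
    rw [QuadraticMap.map_add q, QuadraticMap.map_smul, QuadraticMap.map_smul,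
      QuadraticMap.polar_smul_left, QuadraticMap.polar_smul_right, (hb i i).2.2, if_pos rfl,
      binaryForm_apply]
    simp only [smul_eq_mul]
    ring
  · intro i j hij
    have h1 := (hb i j).2.2
    have h2 := (hb j i).2.2
    rw [if_neg hij] at h1
    rw [if_neg hij.symm, QuadraticMap.polar_comm] at h2
    simp only [QuadraticMap.polar_add_left, QuadraticMap.polar_add_right,
      QuadraticMap.polar_smul_left, QuadraticMap.polar_smul_right, (hb i j).1, (hb i j).2.1, h1, h2,
      smul_zero, add_zero]

/-- Gauss sums are multiplicative over orthogonal sums, and the left side is independent of the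
basis. -/
theorem IsSymplecticBasis.sum_signOfBit {V : Type*} [AddCommGroup V] [Module (ZMod 2) V]
    [Fintype V] {q : QuadraticForm (ZMod 2) V} {n : ℕ}
    {b : Module.Basis (Fin n ⊕ Fin n) (ZMod 2) V} (hb : IsSymplecticBasis q b) :
    ∑ v, signOfBit (q v) =
      2 ^ n * signOfBit (∑ i : Fin n, q (b (Sum.inl i)) * q (b (Sum.inr i))) := by
  classical
  let e : (Fin n → ZMod 2 × ZMod 2) ≃ (Fin n ⊕ Fin n → ZMod 2) :=
    (Equiv.arrowProdEquivProdArrow (Fin n) (fun _ => ZMod 2) (fun _ => ZMod 2)).trans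
      (Equiv.sumArrowEquivProdArrow (Fin n) (Fin n) (ZMod 2)).symm
  have hprod := Finset.prod_univ_sum (fun _ : Fin n => (univ : Finset (ZMod 2 × ZMod 2)))
    (fun i v => signOfBit (binaryForm (q (b (.inl i))) (q (b (.inr i))) v))
  simp only [sum_signOfBit_binaryForm, prod_mul_distrib, prod_const, card_univ, Fintype.card_fin,
    Fintype.piFinset_univ] at hprod
  rw [signOfBit_sum, hprod]
  rw [← (e.trans b.equivFun.symm.toEquiv).sum_comp]
  refine sum_congr rfl fun v _ => ?_
  rw [← signOfBit_sum]
  congr 1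
  exact hb.map_equivFun_symm (e v)

theorem signOfBit_injective : Function.Injective signOfBit := by decide

theorem IsSymplecticBasis.hasArfInvariant {V : Type*} [AddCommGroup V] [Module (ZMod 2) V]
    {q : QuadraticForm (ZMod 2) V} {n : ℕ}
    {b : Module.Basis (Fin n ⊕ Fin n) (ZMod 2) V} (hb : IsSymplecticBasis q b) :
    HasArfInvariant q
      (((∑ i : Fin n, q (b (Sum.inl i)) * q (b (Sum.inr i)) : ZMod 2)) :
        ZMod 2 ⧸ artinSchreier (ZMod 2)) := by
  refine ⟨⟨n, b, hb⟩, fun m b' hb' => ?_⟩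
  have := Fintype.ofEquiv _ b.equivFun.symm.toEquiv
  congr 1
  have h := hb'.sum_signOfBit.symm.trans hb.sum_signOfBit
  apply signOfBit_injective
  -- Only the signs of the two expressions are compared, so m = n need not be known.
  have hm : (0 : ℤ) < 2 ^ m := by positivity
  have hn : (0 : ℤ) < 2 ^ n := by positivity
  have hs : ∀ a, signOfBit a = 1 ∨ signOfBit a = -1 := by decide
  rcases hs (∑ i : Fin m, q (b' (Sum.inl i)) * q (b' (Sum.inr i))) with h1 | h1 <;>
  rcases hs (∑ i : Fin n, q (b (Sum.inl i)) * q (b (Sum.inr i))) with h2 | h2 <;>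
  rw [h1, h2] at h ⊢ <;> exfalso <;> linarith

/-- The symplectic basis `(eᵢ, fᵢ)` of an orthogonal sum of binary forms. -/
noncomputable def binarySumBasis (n : ℕ) :
    Module.Basis (Fin n ⊕ Fin n) (ZMod 2) (Fin n → ZMod 2 × ZMod 2) :=
  ((Pi.basis fun _ : Fin n => Module.Basis.finTwoProd (ZMod 2))).reindex
    (((Equiv.sigmaEquivProd (Fin n) (Fin 2)).trans
      (Equiv.prodComm (Fin n) (Fin 2))).trans
        ((finTwoEquiv.prodCongr (Equiv.refl _)).trans (Equiv.boolProdEquivSum (Fin n))))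

theorem binarySumBasis_inl (n : ℕ) (i : Fin n) :
    binarySumBasis n (.inl i) = Pi.single i (1, 0) := by
  simp [binarySumBasis, Pi.basis_apply, finTwoEquiv]

theorem binarySumBasis_inr (n : ℕ) (i : Fin n) :
    binarySumBasis n (.inr i) = Pi.single i (0, 1) := by
  simp [binarySumBasis, Pi.basis_apply, finTwoEquiv]

theorem binaryForm_polar {K : Type*} [CommRing K] (a b : K) (v w : K × K) :
    QuadraticMap.polar (binaryForm a b) v w =
      2 * a * v.1 * w.1 + v.1 * w.2 + v.2 * w.1 + 2 * b * v.2 * w.2 := by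
  obtain ⟨x, y⟩ := v
  obtain ⟨z, w⟩ := w
  rw [QuadraticMap.polar, Prod.mk_add_mk, binaryForm_apply, binaryForm_apply, binaryForm_apply]
  ring

theorem single_fst_snd {n : ℕ} (i k : Fin n) (x : ZMod 2) :
    (Pi.single (M := fun _ => ZMod 2 × ZMod 2) i (x, 0) k).2 = 0 := by
  by_cases h : k = i
  · subst h; simp
  · simp [h]

theorem single_snd_fst {n : ℕ} (i k : Fin n) (x : ZMod 2) :
    (Pi.single (M := fun _ => ZMod 2 × ZMod 2) i (0, x) k).1 = 0 := by
  by_cases h : k = i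
  · subst h; simp
  · simp [h]

theorem isSymplecticBasis_pi_binaryForm (n : ℕ) (a b : Fin n → ZMod 2) :
    IsSymplecticBasis (QuadraticMap.pi fun i => binaryForm (a i) (b i)) (binarySumBasis n) := by
  have h2 : (2 : ZMod 2) = 0 := rfl
  intro i j
  simp only [binarySumBasis_inl, binarySumBasis_inr, QuadraticMap.Ring.polar_pi, binaryForm_polar, h2,
    zero_mul, zero_add, add_zero]
  refine ⟨?_, ?_, ?_⟩
  · simp [single_fst_snd]
  · simp [single_snd_fst]
  · rw [sum_eq_single i]
    · by_cases h : i = j <;> simp [h]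
    · intro k _ hk
      simp [hk]
    · simp

theorem hasArfInvariant_pi_binaryForm (n : ℕ) (a b : Fin n → ZMod 2) :
    HasArfInvariant (QuadraticMap.pi fun i => binaryForm (a i) (b i))
      ((∑ i, a i * b i : ZMod 2) : ZMod 2 ⧸ artinSchreier (ZMod 2)) := by
  convert (isSymplecticBasis_pi_binaryForm n a b).hasArfInvariant using 4 with i
  · rw [binarySumBasis_inl, QuadraticMap.pi_apply_single, binaryForm_apply]
    simp
  · rw [binarySumBasis_inr, QuadraticMap.pi_apply_single, binaryForm_apply]
    simp

theorem HasArfInvariant.of_isometryEquiv {K V W : Type*} [Field K] [CharP K 2] [AddCommGroup V]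
    [Module K V] [AddCommGroup W] [Module K W] {q : QuadraticForm K V} {q' : QuadraticForm K W}
    {a : K ⧸ artinSchreier K} (h : HasArfInvariant q a) (e : q.IsometryEquiv q') :
    HasArfInvariant q' a := by
  have hp : ∀ v w, QuadraticMap.polar q' (e v) (e w) = QuadraticMap.polar q v w := fun v w => by
    have := e.map_app (v + w)
    rw [map_add] at this
    simp [QuadraticMap.polar, this]
  obtain ⟨⟨n, b, hb⟩, h⟩ := h
  refine ⟨⟨n, b.map e.toLinearEquiv, fun i j => ?_⟩, fun m b' hb' => ?_⟩
  · have := hb i j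
    simp only [← hp] at this
    exact this
  · have hb2 : IsSymplecticBasis q (b'.map e.toLinearEquiv.symm) := fun i j => by
      have := hb' i j
      simp only [← hp, Module.Basis.map_apply]
      have he : ∀ v, e (e.toLinearEquiv.symm v) = v := e.toLinearEquiv.apply_symm_apply
      simpa only [he] using this
    rw [← h m _ hb2]
    congr 1
    refine sum_congr rfl fun i _ => ?_
    simp only [← e.map_app, Module.Basis.map_apply]
    have he : ∀ v, e (e.toLinearEquiv.symm v) = v := e.toLinearEquiv.apply_symm_apply
    simp only [he]

theorem hyperbolicForm_hasArfInvariant (n : ℕ) : HasArfInvariant (hyperbolicForm n) 0 := by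
  have := hasArfInvariant_pi_binaryForm n 0 0
  simp only [Pi.zero_apply, mul_zero, sum_const_zero] at this
  exact this

/-- `[1,1] ⊥ [0,0] ⊥ ⋯ ⊥ [0,0]` as a sum indexed by `Fin (m + 1)`. -/
def ellipticFormIsometryEquivPi (m : ℕ) :
    (QuadraticMap.pi fun i : Fin (m + 1) => binaryForm (Pi.single (M := fun _ => ZMod 2) 0 1 i)
      (Pi.single (M := fun _ => ZMod 2) 0 1 i)).IsometryEquiv (ellipticForm m) where
  __ := Fin.consLinearEquiv (ZMod 2) (fun _ : Fin (m + 1) => ZMod 2 × ZMod 2) |>.symm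
  map_app' v := by
    simp [ellipticForm, hyperbolicForm, Fin.sum_univ_succ, Fin.tail]

theorem ellipticForm_hasArfInvariant (m : ℕ) :
    HasArfInvariant (ellipticForm m) ((1 : ZMod 2) : ZMod 2 ⧸ artinSchreier (ZMod 2)) := by
  have := (hasArfInvariant_pi_binaryForm (m + 1) _ _).of_isometryEquiv
    (ellipticFormIsometryEquivPi m)
  simpa [Fin.sum_univ_succ] using this

theorem one_ne_zero_quotient_artinSchreier :
    ((1 : ZMod 2) : ZMod 2 ⧸ artinSchreier (ZMod 2)) ≠ 0 := by
  rw [Ne, QuotientAddGroup.eq_zero_iff, artinSchreier_zmod_two]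
  simp

end Arf

/-! ### Splitting a space by a rotation and a reflection -/

section DihedralPair

variable {K V : Type*} [Field K] [AddCommGroup V] [Module K V]

/-- Operators satisfying the relations of a rotation `R` and a reflection `S` in a representation
of the dihedral group of order `8` in which the center acts by signs. -/
structure IsDihedralPair (R S : Module.End K V) : Prop where
  reflection_sq : ∀ v, S (S v) = v
  rotation_sq : ∀ v, R (R v) = -v
  anticomm : ∀ v, S (R v) = -R (S v)

/-- The space of fixed vectors of an operator. -/
def fixedSpace (S : Module.End K V) : Submodule K V := LinearMap.ker (S - 1)

theorem mem_fixedSpace_iff {S : Module.End K V} {v : V} : v ∈ fixedSpace S ↔ S v = v := by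
  rw [fixedSpace, LinearMap.mem_ker, LinearMap.sub_apply, Module.End.one_apply, sub_eq_zero]

/-- The whole space is the sum of the fixed space of the reflection and its rotated copy. -/
def IsDihedralPair.splitEquiv {R S : Module.End K V} (h : IsDihedralPair R S) (h2 : (2 : K) ≠ 0) :
    (fixedSpace S × fixedSpace S) ≃ₗ[K] V where
  toFun p := p.1 + R p.2
  -- The vector (v - S v)/2 lies in the -1 eigenspace of S, and R⁻¹ = -R carries it into the fixed
  -- space.
  invFun v := (⟨(2 : K)⁻¹ • (v + S v), mem_fixedSpace_iff.2 (by
      rw [map_smul, map_add, h.reflection_sq, add_comm])⟩,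
    ⟨(2 : K)⁻¹ • R (S v - v), mem_fixedSpace_iff.2 (by
      rw [map_smul, h.anticomm, map_sub, h.reflection_sq, ← map_neg, neg_sub])⟩)
  left_inv := by
    rintro ⟨⟨a, ha⟩, ⟨b, hb⟩⟩
    rw [mem_fixedSpace_iff] at ha hb
    refine Prod.ext (Subtype.ext ?_) (Subtype.ext ?_)
    · change (2 : K)⁻¹ • (a + R b + S (a + R b)) = a
      rw [map_add, ha, h.anticomm, hb, add_add_add_comm, add_neg_cancel, add_zero, ← two_smul K,
        smul_smul, inv_mul_cancel₀ h2, one_smul]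
    · change (2 : K)⁻¹ • R (S (a + R b) - (a + R b)) = b
      rw [map_add, ha, h.anticomm, hb, add_sub_add_left_eq_sub, map_sub, map_neg, h.rotation_sq,
        neg_neg, sub_neg_eq_add, ← two_smul K, smul_smul, inv_mul_cancel₀ h2, one_smul]
  right_inv v := by
    change (2 : K)⁻¹ • (v + S v) + R ((2 : K)⁻¹ • R (S v - v)) = v
    rw [map_smul, h.rotation_sq, ← smul_add, neg_sub, add_add_sub_cancel, ← two_smul K,
      smul_smul, inv_mul_cancel₀ h2, one_smul]
  map_add' p p' := by
    simp only [Prod.fst_add, Prod.snd_add, Submodule.coe_add, map_add]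
    abel
  map_smul' c p := by simp

theorem IsDihedralPair.finrank_eq [FiniteDimensional K V] {R S : Module.End K V}
    (h : IsDihedralPair R S) (h2 : (2 : K) ≠ 0) :
    Module.finrank K V = 2 * Module.finrank K (fixedSpace S) := by
  rw [← (h.splitEquiv h2).finrank_eq, Module.finrank_prod, two_mul]

end DihedralPair

/-! ### Real bases lifted from the fixed space -/

section RealStructure

variable {V : Type*} [AddCommGroup V] [Module ℂ V] {ι : Type*}

/-- The operator `T` has real entries in the basis `b`. -/
def PreservesRealSpan (b : Module.Basis ι ℂ V) (T : Module.End ℂ V) : Prop :=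
  ∀ v ∈ Submodule.span ℝ (Set.range b), T v ∈ Submodule.span ℝ (Set.range b)

variable {b : Module.Basis ι ℂ V}

theorem preservesRealSpan_of_basis {T : Module.End ℂ V}
    (h : ∀ j, T (b j) ∈ Submodule.span ℝ (Set.range b)) : PreservesRealSpan b T := by
  intro v hv
  have : Submodule.span ℝ (Set.range b) ≤
      (Submodule.span ℝ (Set.range b)).comap (T.restrictScalars ℝ) := by
    rw [Submodule.span_le]
    rintro _ ⟨j, rfl⟩
    exact h j
  exact this hv

theorem PreservesRealSpan.one : PreservesRealSpan b 1 := fun _ hv => hv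

theorem PreservesRealSpan.neg_one : PreservesRealSpan b (-1) := fun _ hv => neg_mem hv

theorem PreservesRealSpan.mul {T T' : Module.End ℂ V} (h : PreservesRealSpan b T)
    (h' : PreservesRealSpan b T') : PreservesRealSpan b (T * T') := fun v hv => h _ (h' v hv)

theorem PreservesRealSpan.pow {T : Module.End ℂ V} (h : PreservesRealSpan b T) :
    ∀ n : ℕ, PreservesRealSpan b (T ^ n)
  | 0 => .one
  | n + 1 => by rw [pow_succ]; exact (h.pow n).mul h

theorem isRealizableOverReal_iff {G : Type*} [Group G] {ρ : Representation ℂ G V} :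
    IsRealizableOverReal ρ ↔
      ∃ (d : ℕ) (b : Module.Basis (Fin d) ℂ V), ∀ g, PreservesRealSpan b (ρ g) := by
  refine exists_congr fun d => exists_congr fun b => forall_congr' fun g => ?_
  constructor
  · intro h
    refine preservesRealSpan_of_basis fun j => (b.mem_span_iff_repr_mem ℝ _).2 fun i => ?_
    obtain ⟨r, hr⟩ := h i j
    exact ⟨r, hr.symm⟩
  · intro h i j
    obtain ⟨r, hr⟩ := (b.mem_span_iff_repr_mem ℝ _).1
      (h _ (Submodule.subset_span ⟨j, rfl⟩)) i
    exact ⟨r, hr.symm⟩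

theorem isRealizableOverReal_of_finite [Finite ι] {G : Type*} [Group G] {ρ : Representation ℂ G V}
    (b : Module.Basis ι ℂ V) (h : ∀ g, PreservesRealSpan b (ρ g)) : IsRealizableOverReal ρ := by
  refine isRealizableOverReal_iff.2 ⟨_, b.reindex (Finite.equivFin ι), fun g => ?_⟩
  rw [PreservesRealSpan, Module.Basis.range_reindex]
  exact h g

variable {R S : Module.End ℂ V}

/-- A basis of the fixed space of the reflection together with its rotated copy. -/
noncomputable def IsDihedralPair.basis (h : IsDihedralPair R S)
    (b : Module.Basis ι ℂ (fixedSpace S)) : Module.Basis (ι ⊕ ι) ℂ V :=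
  (b.prod b).map (h.splitEquiv two_ne_zero)

theorem IsDihedralPair.basis_inl (h : IsDihedralPair R S) (b : Module.Basis ι ℂ (fixedSpace S))
    (i : ι) : h.basis b (.inl i) = b i := by
  simp [IsDihedralPair.basis, IsDihedralPair.splitEquiv]

theorem IsDihedralPair.basis_inr (h : IsDihedralPair R S) (b : Module.Basis ι ℂ (fixedSpace S))
    (i : ι) : h.basis b (.inr i) = R (b i) := by
  simp [IsDihedralPair.basis, IsDihedralPair.splitEquiv]

theorem IsDihedralPair.preservesRealSpan_rotation (h : IsDihedralPair R S)
    (b : Module.Basis ι ℂ (fixedSpace S)) : PreservesRealSpan (h.basis b) R := by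
  refine preservesRealSpan_of_basis ?_
  rintro (i | i)
  · rw [h.basis_inl, ← h.basis_inr b]
    exact Submodule.subset_span ⟨_, rfl⟩
  · rw [h.basis_inr, h.rotation_sq, ← h.basis_inl b]
    exact neg_mem (Submodule.subset_span ⟨_, rfl⟩)

theorem IsDihedralPair.preservesRealSpan_reflection (h : IsDihedralPair R S)
    (b : Module.Basis ι ℂ (fixedSpace S)) : PreservesRealSpan (h.basis b) S := by
  refine preservesRealSpan_of_basis ?_
  rintro (i | i)
  · rw [h.basis_inl, mem_fixedSpace_iff.1 (b i).2, ← h.basis_inl b]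
    exact Submodule.subset_span ⟨_, rfl⟩
  · rw [h.basis_inr, h.anticomm, mem_fixedSpace_iff.1 (b i).2, ← h.basis_inr b]
    exact neg_mem (Submodule.subset_span ⟨_, rfl⟩)

/-- On the rotated copy T is determined by T R = R T, and R is itself real in this basis. -/
theorem IsDihedralPair.preservesRealSpan_of_commute (h : IsDihedralPair R S)
    (b : Module.Basis ι ℂ (fixedSpace S)) {T : Module.End ℂ V} (hR : ∀ v, T (R v) = R (T v))
    (T' : Module.End ℂ (fixedSpace S)) (hT : ∀ v : fixedSpace S, T v = T' v) (hT' : PreservesRealSpan b T') :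
    PreservesRealSpan (h.basis b) T := by
  have key : ∀ i, T (b i) ∈ Submodule.span ℝ (Set.range (h.basis b)) := fun i => by
    rw [hT]
    have h1 := Submodule.mem_map_of_mem (f := (fixedSpace S).subtype.restrictScalars ℝ)
      (hT' _ (Submodule.subset_span ⟨i, rfl⟩))
    rw [Submodule.map_span] at h1
    refine Submodule.span_mono ?_ h1
    rintro _ ⟨_, ⟨j, rfl⟩, rfl⟩
    exact ⟨.inl j, h.basis_inl b j⟩
  refine preservesRealSpan_of_basis ?_
  rintro (i | i)
  · rw [h.basis_inl]
    exact key i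
  · rw [h.basis_inr, hR]
    exact h.preservesRealSpan_rotation b _ (key i)

end RealStructure

/-! ### Representations with the central involution acting by -1 -/

section SignOnCenter

variable {K V G : Type*} [Field K] [AddCommGroup V] [Module K V] [Group G]

/-- The nontrivial central elements act by `-1`. -/
def SignOnCenter (ρ : Representation K G V) : Prop :=
  ∀ z ∈ Subgroup.center G, z ≠ 1 → ρ z = -1

/-- The dihedral relation is written with an explicit r² because ρ turns that factor into -1. -/
theorem SignOnCenter.isDihedralPair {ρ : Representation K G V} (hρ : SignOnCenter ρ) {r s : G}
    (hs : s ^ 2 = 1) (hr : r ^ 2 ∈ Subgroup.center G) (hr1 : r ^ 2 ≠ 1)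
    (hsr : s * r = r ^ 2 * (r * s)) : IsDihedralPair (ρ r) (ρ s) where
  reflection_sq v := by
    rw [← Module.End.mul_apply, ← map_mul, ← pow_two, hs, map_one, Module.End.one_apply]
  rotation_sq v := by
    rw [← Module.End.mul_apply, ← map_mul, ← pow_two, hρ _ hr hr1]
    rfl
  anticomm v := by
    rw [← Module.End.mul_apply, ← map_mul, hsr, map_mul, hρ _ hr hr1, map_mul]
    rfl

namespace TwoCenteredGroup

/-- A rotation of order four. -/
def D4r : D4 := (DihedralGroup.r 1 : DihedralGroup 4)

/-- A reflection. -/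
def D4s : D4 := (DihedralGroup.sr 0 : DihedralGroup 4)

theorem D4r_sq_ne_one : D4r ^ 2 ≠ 1 := by
  have : (DihedralGroup.r 1 : DihedralGroup 4) ^ 2 ≠ 1 := by decide
  exact this

theorem D4s_sq : D4s ^ 2 = 1 := by
  have : (DihedralGroup.sr 0 : DihedralGroup 4) ^ 2 = 1 := by decide
  exact this

theorem D4s_mul_D4r : D4s * D4r = D4r ^ 2 * (D4r * D4s) := by
  have : (DihedralGroup.sr 0 : DihedralGroup 4) * .r 1 = .r 1 ^ 2 * (.r 1 * .sr 0) := by decide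
  exact this

theorem D4_exists_eq (d : D4) : ∃ i : ℕ, d = D4r ^ i ∨ d = D4s * D4r ^ i := by
  have : ∀ d : DihedralGroup 4, ∃ i : Fin 4, d = .r 1 ^ (i : ℕ) ∨ d = .sr 0 * .r 1 ^ (i : ℕ) := by
    decide
  obtain ⟨i, hi⟩ := this d
  exact ⟨i, hi⟩

variable {G : TwoCenteredGroup}

theorem isDihedralPair_D4 {ρ : Representation K D4 V} (hρ : SignOnCenter ρ) :
    IsDihedralPair (ρ D4r) (ρ D4s) :=
  hρ.isDihedralPair D4s_sq (D4_sq_mem_center _) D4r_sq_ne_one D4s_mul_D4r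

/-- The embedding of the first factor of a central product with `D₄`. -/
noncomputable def inlD4 (G : TwoCenteredGroup) : G →* G.centralProd D4 :=
  (centralProdMk G D4).comp (MonoidHom.inl G D4)

/-- The embedding of the second factor of a central product with `D₄`. -/
noncomputable def inrD4 (G : TwoCenteredGroup) : D4 →* G.centralProd D4 :=
  (centralProdMk G D4).comp (MonoidHom.inr G D4)

theorem inlD4_commute (g : G) (d : D4) : Commute (inlD4 G g) (inrD4 G d) := by
  change _ * _ = _ * _
  change centralProdMk G D4 (g, 1) * centralProdMk G D4 (1, d) =
    centralProdMk G D4 (1, d) * centralProdMk G D4 (g, 1)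
  rw [← map_mul, ← map_mul]
  simp

theorem exists_eq_inlD4_mul_inrD4 (x : G.centralProd D4) : ∃ g d, x = inlD4 G g * inrD4 G d := by
  obtain ⟨⟨g, d⟩, rfl⟩ := centralProdMk_surjective x
  refine ⟨g, d, ?_⟩
  change _ = centralProdMk G D4 (g, 1) * centralProdMk G D4 (1, d)
  rw [← map_mul]
  simp

theorem signOnCenter_comp_inlD4 {ρ : Representation K (G.centralProd D4) V} (hρ : SignOnCenter ρ) :
    SignOnCenter (V := V) (ρ.comp (inlD4 G)) := by
  intro z hz hz1
  refine hρ _ (centralProdMk_mem_center hz (one_mem _)) fun e => hz1 ?_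
  exact ((centralProdMk_eq_one_iff.1 e).2.2).2 rfl

theorem signOnCenter_comp_inrD4 {ρ : Representation K (G.centralProd D4) V} (hρ : SignOnCenter ρ) :
    SignOnCenter (V := V) (ρ.comp (inrD4 G)) := by
  intro z hz hz1
  refine hρ _ (centralProdMk_mem_center (one_mem _) hz) fun e => hz1 ?_
  exact ((centralProdMk_eq_one_iff.1 e).2.2).1 rfl

/-- The action of the first factor on the vectors fixed by a reflection of the second factor. -/
noncomputable def fixedRepresentation (ρ : Representation K (G.centralProd D4) V) :
    Representation K G (fixedSpace (ρ (inrD4 G D4s))) where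
  toFun g := (ρ (inlD4 G g)).restrict fun v hv => by
    rw [mem_fixedSpace_iff] at hv ⊢
    rw [← Module.End.mul_apply, ← map_mul, ← (inlD4_commute g D4s).eq, map_mul,
      Module.End.mul_apply, hv]
  map_one' := by
    ext v
    simp [LinearMap.restrict_apply]
  map_mul' g g' := by
    ext v
    simp [LinearMap.restrict_apply]

theorem fixedRepresentation_apply (ρ : Representation K (G.centralProd D4) V) (g : G)
    (v : fixedSpace (ρ (inrD4 G D4s))) :
    (fixedRepresentation ρ g v : V) = ρ (inlD4 G g) v := rfl

theorem signOnCenter_fixedRepresentation {ρ : Representation K (G.centralProd D4) V}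
    (hρ : SignOnCenter ρ) : SignOnCenter (fixedRepresentation ρ) := by
  intro z hz hz1
  refine LinearMap.ext fun v => Subtype.ext ?_
  rw [fixedRepresentation_apply]
  exact LinearMap.congr_fun (signOnCenter_comp_inlD4 hρ z hz hz1) (v : V)

end TwoCenteredGroup

end SignOnCenter

/-! ### Realizability over ℝ for D₄^{(n)} -/

namespace TwoCenteredGroup

variable {G : TwoCenteredGroup}

section Realizable

variable {V : Type*} [AddCommGroup V] [Module ℂ V]

theorem preservesRealSpan_of_D4 {ι : Type*} {b : Module.Basis ι ℂ V} {ρ : Representation ℂ D4 V}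
    (hr : PreservesRealSpan b (ρ D4r)) (hs : PreservesRealSpan b (ρ D4s)) (d : D4) :
    PreservesRealSpan b (ρ d) := by
  obtain ⟨i, rfl | rfl⟩ := D4_exists_eq d
  · rw [map_pow]
    exact hr.pow i
  · rw [map_mul, map_pow]
    exact hs.mul (hr.pow i)

theorem isRealizableOverReal_D4 [FiniteDimensional ℂ V] {ρ : Representation ℂ D4 V}
    (hρ : SignOnCenter ρ) : IsRealizableOverReal ρ :=
  isRealizableOverReal_of_finite ((isDihedralPair_D4 hρ).basis (Module.finBasis ℂ _))
    (preservesRealSpan_of_D4 (IsDihedralPair.preservesRealSpan_rotation _ _)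
      (IsDihedralPair.preservesRealSpan_reflection _ _))

theorem isRealizableOverReal_centralProd_D4 {ρ : Representation ℂ (G.centralProd D4) V}
    (hρ : SignOnCenter ρ) (h : IsRealizableOverReal (fixedRepresentation ρ)) :
    IsRealizableOverReal ρ := by
  obtain ⟨d, b, hb⟩ := isRealizableOverReal_iff.1 h
  have hD := isDihedralPair_D4 (signOnCenter_comp_inrD4 hρ)
  refine isRealizableOverReal_of_finite (hD.basis b) fun x => ?_
  obtain ⟨g, d, rfl⟩ := exists_eq_inlD4_mul_inrD4 x
  rw [map_mul]
  refine PreservesRealSpan.mul ?_ ?_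
  · refine hD.preservesRealSpan_of_commute b (fun v => ?_) (fixedRepresentation ρ g)
      (fun v => rfl) (hb g)
    change (ρ (inlD4 G g) * ρ (inrD4 G D4r)) v = (ρ (inrD4 G D4r) * ρ (inlD4 G g)) v
    rw [← map_mul, ← map_mul, (inlD4_commute g D4r).eq]
  · exact preservesRealSpan_of_D4 (ρ := ρ.comp (inrD4 G)) (hD.preservesRealSpan_rotation b)
      (hD.preservesRealSpan_reflection b) d

/-- Irreducibility is not assumed, so the induction may pass to the fixed space without checking
that it stays irreducible. -/
theorem isRealizableOverReal_of_signOnCenter [FiniteDimensional ℂ V] (k : ℕ)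
    {ρ : Representation ℂ (centralProdD4 D4 k) V} (hρ : SignOnCenter ρ) :
    IsRealizableOverReal ρ := by
  induction k generalizing V with
  | zero => exact isRealizableOverReal_D4 hρ
  | succ k ih =>
    exact isRealizableOverReal_centralProd_D4 hρ (ih (signOnCenter_fixedRepresentation hρ))

end Realizable

end TwoCenteredGroup

/-! ### Irreducible representations and the action of the center -/

section Irreducible

variable {K V G : Type*} [Field K] [AddCommGroup V] [Module K V] [Group G]

/-- This replaces Schur's lemma over any field: the fixed space of ρ g is invariant, and if it is
zero then so is every fixed vector ρ g v + v. -/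
theorem eq_one_or_eq_neg_one_of_isIrreducible {ρ : Representation K G V} (hρ : ρ.IsIrreducible)
    {g : G} (hg : ρ g * ρ g = 1) (hcomm : ∀ h, ρ g * ρ h = ρ h * ρ g) :
    ρ g = 1 ∨ ρ g = -1 := by
  let W : Subrepresentation ρ := ⟨fixedSpace (ρ g), fun h v hv => by
    rw [mem_fixedSpace_iff] at hv ⊢
    rw [← Module.End.mul_apply, hcomm, Module.End.mul_apply, hv]⟩
  rcases hρ.eq_bot_or_eq_top W with h | h
  · right
    ext v
    have hv : ρ g v + v ∈ fixedSpace (ρ g) := by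
      rw [mem_fixedSpace_iff, map_add, ← Module.End.mul_apply, hg, Module.End.one_apply, add_comm]
    have h' : fixedSpace (ρ g) = ⊥ := congrArg Subrepresentation.toSubmodule h
    rw [h', Submodule.mem_bot] at hv
    exact eq_neg_of_add_eq_zero_left hv
  · left
    have h' : fixedSpace (ρ g) = ⊤ := congrArg Subrepresentation.toSubmodule h
    ext v
    exact mem_fixedSpace_iff.1 (h' ▸ Submodule.mem_top : v ∈ fixedSpace (ρ g))

theorem signOnCenter_or_center_trivial {ρ : Representation K G V} (hρ : ρ.IsIrreducible)
    (hc : Nat.card (Subgroup.center G) = 2) :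
    SignOnCenter ρ ∨ ∀ z ∈ Subgroup.center G, ρ z = 1 := by
  obtain ⟨z, hz, hz1⟩ := exists_mem_center_ne_one hc
  have huniq : ∀ y ∈ Subgroup.center G, y ≠ 1 → y = z := fun y hy hy1 =>
    eq_of_mem_center_of_ne_one hc hy hz hy1 hz1
  rcases eq_one_or_eq_neg_one_of_isIrreducible hρ (g := z)
    (by rw [← map_mul, ← pow_two, sq_eq_one_of_mem_center hc hz, map_one])
    (fun h => by rw [← map_mul, ← map_mul, Subgroup.mem_center_iff.1 hz h]) with h | h
  · refine Or.inr fun y hy => ?_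
    by_cases hy1 : y = 1
    · rw [hy1, map_one]
    · rw [huniq y hy hy1, h]
  · exact Or.inl fun y hy hy1 => by rw [huniq y hy hy1, h]

-- Commutators and squares act trivially, so each ρ g is an involution commuting with all operators,
-- hence ±1, which is real in any basis.
open scoped commutatorElement in
theorem isRealizableOverReal_of_center_trivial {V : Type*} [AddCommGroup V] [Module ℂ V]
    [FiniteDimensional ℂ V] {ρ : Representation ℂ G V} (hρ : ρ.IsIrreducible)
    (hsq : ∀ x : G, x ^ 2 ∈ Subgroup.center G) (h : ∀ z ∈ Subgroup.center G, ρ z = 1) :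
    IsRealizableOverReal ρ := by
  refine isRealizableOverReal_of_finite (Module.finBasis ℂ V) fun g => ?_
  have hcomm : ∀ h, ρ g * ρ h = ρ h * ρ g := fun y => by
    have : g * y = ⁅g, y⁆ * (y * g) := by rw [commutatorElement_def]; group
    rw [← map_mul, this, map_mul, h _ (commutatorElement_mem_center hsq g y), one_mul, map_mul]
  rcases eq_one_or_eq_neg_one_of_isIrreducible hρ
    (by rw [← map_mul, ← pow_two, h _ (hsq g)]) hcomm with h | h
  · rw [h]; exact .one
  · rw [h]; exact .neg_one

/-- A minimal nonzero subrepresentation exists by finite dimension; its own subrepresentations are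
also subrepresentations of V. -/
theorem exists_isIrreducible_subrepresentation [FiniteDimensional K V] [Nontrivial V]
    (ρ : Representation K G V) :
    ∃ W : Subrepresentation ρ, W.toRepresentation.IsIrreducible := by
  have hwf : WellFoundedLT (Subrepresentation ρ) :=
    ⟨Subrelation.wf (fun {a b} h => h)
      (InvImage.wf Subrepresentation.toSubmodule (wellFounded_lt (α := Submodule K V)))⟩
  have hne : (⊤ : Subrepresentation ρ) ≠ ⊥ := fun h =>
    top_ne_bot (congrArg Subrepresentation.toSubmodule h : (⊤ : Submodule K V) = ⊥)
  have := isAtomic_of_orderBot_wellFounded_lt hwf.wf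
  obtain ⟨W, hW, -⟩ := (eq_bot_or_exists_atom_le (⊤ : Subrepresentation ρ)).resolve_left hne
  refine ⟨W, ?_⟩
  have hbot : W.toSubmodule ≠ ⊥ := fun h => hW.1 (Subrepresentation.toSubmodule_injective h)
  have hnt : Nontrivial (Subrepresentation W.toRepresentation) := by
    refine ⟨⟨⊥, ⊤, fun h => hbot ?_⟩⟩
    have h' : (⊥ : Submodule K W.toSubmodule) = ⊤ := congrArg Subrepresentation.toSubmodule h
    rw [Submodule.eq_bot_iff]
    intro v hv
    have : (⟨v, hv⟩ : W.toSubmodule) ∈ (⊥ : Submodule K W.toSubmodule) := h' ▸ Submodule.mem_top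
    exact congrArg Subtype.val ((Submodule.mem_bot K).1 this)
  refine { hnt with eq_bot_or_eq_top := fun U => ?_ }
  let U' : Subrepresentation ρ := ⟨U.toSubmodule.map W.toSubmodule.subtype, by
    rintro g _ ⟨u, hu, rfl⟩
    exact ⟨W.toRepresentation g u, U.apply_mem_toSubmodule g hu, rfl⟩⟩
  have hU' : U' ≤ W := by
    rintro _ ⟨u, hu, rfl⟩
    exact u.2
  rcases hW.le_iff.1 hU' with h | h
  · left
    apply Subrepresentation.toSubmodule_injective
    have h' : U.toSubmodule.map W.toSubmodule.subtype = ⊥ :=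
      congrArg Subrepresentation.toSubmodule h
    refine Submodule.map_injective_of_injective (Submodule.injective_subtype _) ?_
    exact h'.trans (Submodule.map_bot _).symm
  · right
    apply Subrepresentation.toSubmodule_injective
    have h' : U.toSubmodule.map W.toSubmodule.subtype = W.toSubmodule :=
      congrArg Subrepresentation.toSubmodule h
    change U.toSubmodule = ⊤
    rw [eq_top_iff]
    rintro ⟨v, hv⟩ -
    rw [← h'] at hv
    obtain ⟨u, hu, rfl⟩ := hv
    exact hu

end Irreducible

/-! ### A lower bound for real representations of Q₂D₄^{(k)} -/

section RealDimension

variable {V : Type*} [AddCommGroup V] [Module ℝ V]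

/-- A real vector space with two anticommuting operators of square `-1` has dimension at least
four, unless it is zero. -/
theorem four_le_finrank_of_quaternionic [FiniteDimensional ℝ V] [Nontrivial V]
    {I J : Module.End ℝ V} (hI : ∀ v, I (I v) = -v) (hJ : ∀ v, J (J v) = -v)
    (hIJ : ∀ v, J (I v) = -I (J v)) : 4 ≤ Module.finrank ℝ V := by
  obtain ⟨v, hv⟩ := exists_ne (0 : V)
  have hli : LinearIndependent ℝ ![v, I v, J v, I (J v)] := by
    rw [Fintype.linearIndependent_iff]
    intro c hc
    simp only [Fin.sum_univ_four, Matrix.cons_val] at hc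
    have hc1 := congrArg I hc
    have hc2 := congrArg J hc
    have hc3 := congrArg I hc2
    simp only [map_add, map_smul, hI, hJ, hIJ, map_neg, map_zero] at hc1 hc2 hc3
    -- Multiply the relation by the conjugate quaternion c₀ - c₁I - c₂J - c₃IJ: the product is the
    -- norm of c, and it kills v.
    have key : (c 0 ^ 2 + c 1 ^ 2 + c 2 ^ 2 + c 3 ^ 2) • v = 0 := by
      have : (c 0 ^ 2 + c 1 ^ 2 + c 2 ^ 2 + c 3 ^ 2) • v =
          c 0 • (0 : V) - c 1 • (0 : V) - c 2 • (0 : V) - c 3 • (0 : V) := by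
        nth_rewrite 1 [← hc]
        nth_rewrite 1 [← hc1]
        nth_rewrite 1 [← hc2]
        nth_rewrite 1 [← hc3]
        module
      rw [this]
      simp
    have h0 := (smul_eq_zero.1 key).resolve_right hv
    intro i
    rw [← sq_eq_zero_iff]
    have := sq_nonneg (c 0)
    have := sq_nonneg (c 1)
    have := sq_nonneg (c 2)
    have := sq_nonneg (c 3)
    fin_cases i <;> simp only [Fin.zero_eta, Fin.mk_one, Fin.reduceFinMk] <;> linarith
  simpa using hli.fintype_card_le_finrank

namespace TwoCenteredGroup

/-- An element of order four. -/
def Q2i : Q2 := (QuaternionGroup.a 1 : QuaternionGroup 2)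

/-- An element of order four that does not commute with `Q2i`. -/
def Q2j : Q2 := (QuaternionGroup.xa 0 : QuaternionGroup 2)

theorem Q2_relations : Q2i ^ 2 ≠ 1 ∧ Q2j ^ 2 ≠ 1 ∧ Q2j * Q2i = Q2i ^ 2 * (Q2i * Q2j) := by
  have : (.a 1 : QuaternionGroup 2) ^ 2 ≠ 1 ∧ (.xa 0 : QuaternionGroup 2) ^ 2 ≠ 1 ∧
    (.xa 0 : QuaternionGroup 2) * .a 1 = .a 1 ^ 2 * (.a 1 * .xa 0) := by decide
  exact this

/-- Q₂ contributes the factor 4, and each D₄ doubles the dimension of its fixed space. -/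
theorem le_finrank_of_signOnCenter [FiniteDimensional ℝ V] [Nontrivial V] (k : ℕ)
    {ρ : Representation ℝ (centralProdD4 Q2 k) V} (hρ : SignOnCenter ρ) :
    2 ^ (k + 2) ≤ Module.finrank ℝ V := by
  induction k generalizing V with
  | zero =>
    obtain ⟨h1, h2, h3⟩ := Q2_relations
    let ρ' : Representation ℝ Q2 V := ρ
    have hρ' : SignOnCenter ρ' := hρ
    refine four_le_finrank_of_quaternionic (I := ρ' Q2i) (J := ρ' Q2j) (fun v => ?_) (fun v => ?_)
      (fun v => ?_)
    · rw [← Module.End.mul_apply, ← map_mul, ← pow_two, hρ' _ (Q2_sq_mem_center _) h1]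
      rfl
    · rw [← Module.End.mul_apply, ← map_mul, ← pow_two, hρ' _ (Q2_sq_mem_center _) h2]
      rfl
    · rw [← Module.End.mul_apply, ← map_mul, h3, map_mul, hρ' _ (Q2_sq_mem_center _) h1, map_mul]
      rfl
  | succ k ih =>
    let ρ' : Representation ℝ ((centralProdD4 Q2 k).centralProd D4) V := ρ
    have hρ' : SignOnCenter ρ' := hρ
    have hd := (isDihedralPair_D4 (signOnCenter_comp_inrD4 hρ')).finrank_eq two_ne_zero
    have hpos : 0 < Module.finrank ℝ V := Module.finrank_pos
    have hnt : Nontrivial (fixedSpace (ρ' (inrD4 (centralProdD4 Q2 k) D4s))) := by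
      apply Module.nontrivial_of_finrank_pos (R := ℝ)
      change _ = 2 * Module.finrank ℝ (fixedSpace (ρ' (inrD4 (centralProdD4 Q2 k) D4s))) at hd
      omega
    have := ih (signOnCenter_fixedRepresentation hρ')
    rw [hd, pow_succ, mul_comm]
    exact Nat.mul_le_mul_left 2 this

end TwoCenteredGroup

/-- A representation that is real in a basis acts on the real span of this basis. -/
noncomputable def realSpanRepresentation {G V ι : Type*} [Group G] [AddCommGroup V] [Module ℂ V]
    (ρ : Representation ℂ G V) (b : Module.Basis ι ℂ V) (h : ∀ g, PreservesRealSpan b (ρ g)) :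
    Representation ℝ G (Submodule.span ℝ (Set.range b)) where
  toFun g := ((ρ g).restrictScalars ℝ).restrict (h g)
  map_one' := by
    ext v
    simp [LinearMap.restrict_apply]
  map_mul' g g' := LinearMap.ext fun v =>
    Subtype.ext (LinearMap.congr_fun (map_mul ρ g g') (v : V))

theorem finrank_span_range_real {V ι : Type*} [AddCommGroup V] [Module ℂ V] [Fintype ι]
    (b : Module.Basis ι ℂ V) :
    Module.finrank ℝ (Submodule.span ℝ (Set.range b)) = Module.finrank ℂ V := by
  rw [finrank_span_eq_card (b.linearIndependent.restrict_scalars' ℝ),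
    Module.finrank_eq_card_basis b]

/-- A real form would have real dimension `finrank ℂ V` with the center still acting by signs, below
the bound. -/
theorem TwoCenteredGroup.not_isRealizableOverReal {V : Type*} [AddCommGroup V] [Module ℂ V]
    [FiniteDimensional ℂ V] [Nontrivial V] (k : ℕ)
    {ρ : Representation ℂ (centralProdD4 Q2 k) V} (hρ : SignOnCenter ρ)
    (hd : Module.finrank ℂ V < 2 ^ (k + 2)) : ¬ IsRealizableOverReal ρ := by
  intro h
  obtain ⟨d, b, hb⟩ := isRealizableOverReal_iff.1 h
  have hfin := finrank_span_range_real b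
  have hpos : 0 < Module.finrank ℂ V := Module.finrank_pos
  have : FiniteDimensional ℝ (Submodule.span ℝ (Set.range b)) :=
    FiniteDimensional.span_of_finite ℝ (Set.finite_range b)
  have : Nontrivial (Submodule.span ℝ (Set.range b)) :=
    Module.nontrivial_of_finrank_pos (R := ℝ) (hfin ▸ hpos)
  have hs : SignOnCenter (realSpanRepresentation ρ b hb) := fun z hz hz1 => by
    refine LinearMap.ext fun v => Subtype.ext ?_
    exact LinearMap.congr_fun (hρ z hz hz1) (v : V)
  have := le_finrank_of_signOnCenter k hs
  omega

end RealDimension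

/-! ### Small complex representations of Q₂D₄^{(k)} and the conclusion -/

open scoped TensorProduct

namespace TwoCenteredGroup

/-- The two-dimensional integral representation of `D₄`. -/
def D4Matrix : DihedralGroup 4 → Matrix (Fin 2) (Fin 2) ℤ
  | .r i => !![0, -1; 1, 0] ^ i.val
  | .sr i => !![1, 0; 0, -1] * !![0, -1; 1, 0] ^ i.val

theorem D4Matrix_mul : ∀ x y, D4Matrix (x * y) = D4Matrix x * D4Matrix y := by decide

theorem D4Matrix_one : D4Matrix 1 = 1 := by decide

/-- The two-dimensional representation of `Q₂` over the Gaussian integers. -/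
def Q2Matrix : QuaternionGroup 2 → Matrix (Fin 2) (Fin 2) GaussianInt
  | .a i => !![⟨0, 1⟩, 0; 0, ⟨0, -1⟩] ^ i.val
  | .xa i => !![0, -1; 1, 0] * !![⟨0, 1⟩, 0; 0, ⟨0, -1⟩] ^ i.val

theorem Q2Matrix_mul : ∀ x y, Q2Matrix (x * y) = Q2Matrix x * Q2Matrix y := by decide

theorem Q2Matrix_one : Q2Matrix 1 = 1 := by decide

/-- The complex representation given by a multiplicative family of matrices over a subring. -/
noncomputable def matrixRepresentation {G R : Type*} [Group G] [CommRing R] (φ : R →+* ℂ)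
    (M : G →* Matrix (Fin 2) (Fin 2) R) : Representation ℂ G (Fin 2 → ℂ) :=
  (Matrix.toLinAlgEquiv' (R := ℂ) (n := Fin 2)).toRingEquiv.toRingHom.toMonoidHom.comp
    ((φ.mapMatrix (m := Fin 2)).toMonoidHom.comp M)

theorem signOnCenter_matrixRepresentation {G R : Type*} [Group G] [CommRing R] (φ : R →+* ℂ)
    (M : G →* Matrix (Fin 2) (Fin 2) R) (h : ∀ z, (∀ g, g * z = z * g) → z ≠ 1 → M z = -1) :
    SignOnCenter (matrixRepresentation φ M) := by
  intro z hz hz1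
  change Matrix.toLinAlgEquiv' (φ.mapMatrix (M z)) = -1
  rw [h z (Subgroup.mem_center_iff.1 hz) hz1, map_neg, map_one, map_neg, map_one]

theorem exists_signOnCenter_D4 : ∃ ρ : Representation ℂ D4 (Fin 2 → ℂ), SignOnCenter ρ :=
  ⟨_, signOnCenter_matrixRepresentation (Int.castRingHom ℂ) (G := DihedralGroup 4)
    ⟨⟨D4Matrix, D4Matrix_one⟩, D4Matrix_mul⟩
    (by
      have : ∀ z, (∀ g, g * z = z * g) → z ≠ 1 → D4Matrix z = -1 := by decide
      exact this)⟩

theorem exists_signOnCenter_Q2 : ∃ ρ : Representation ℂ Q2 (Fin 2 → ℂ), SignOnCenter ρ :=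
  ⟨_, signOnCenter_matrixRepresentation GaussianInt.toComplex (G := QuaternionGroup 2)
    ⟨⟨Q2Matrix, Q2Matrix_one⟩, Q2Matrix_mul⟩
    (by
      have : ∀ z, (∀ g, g * z = z * g) → z ≠ 1 → Q2Matrix z = -1 := by decide
      exact this)⟩

/-- On the tensor product a pair of nontrivial central elements acts by (-1)(-1) = 1, so the action
descends. The central involution is the class of a pair with exactly one nontrivial entry, which
acts by -1. -/
theorem exists_signOnCenter_centralProd {K V W : Type*} [Field K] [AddCommGroup V] [Module K V]
    [AddCommGroup W] [Module K W] {G H : TwoCenteredGroup} {ρ : Representation K G V}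
    {σ : Representation K H W} (hρ : SignOnCenter ρ) (hσ : SignOnCenter σ) :
    ∃ τ : Representation K (G.centralProd H) (V ⊗[K] W), SignOnCenter τ := by
  let τ₀ : G × H →* Module.End K (V ⊗[K] W) :=
    { toFun p := TensorProduct.map (ρ p.1) (σ p.2)
      map_one' := by
        rw [Prod.fst_one, Prod.snd_one, map_one, map_one, TensorProduct.map_one]
      map_mul' p p' := by
        rw [Prod.fst_mul, Prod.snd_mul, map_mul, map_mul, TensorProduct.map_mul] }
  have hle : centralKernel (centerEquiv G H) ≤ τ₀.ker := fun p hp => by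
    obtain ⟨h1, h2, h⟩ := (mem_centralKernel_iff G H p).1 hp
    change TensorProduct.map (ρ p.1) (σ p.2) = 1
    by_cases h3 : p.1 = 1
    · rw [h3, h.1 h3, map_one, map_one, TensorProduct.map_one]
    · rw [hρ _ h1 h3, hσ _ h2 fun e => h3 (h.2 e)]
      ext v w
      simp [TensorProduct.neg_tmul, TensorProduct.tmul_neg]
  let τ : G.centralProd H →* Module.End K (V ⊗[K] W) := QuotientGroup.lift _ τ₀ hle
  refine ⟨τ, fun z hz hz1 => ?_⟩
  obtain ⟨p, rfl⟩ := centralProdMk_surjective z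
  obtain ⟨h1, h2⟩ := mem_center_of_centralProdMk_mem_center hz
  rw [Ne, centralProdMk_eq_one_iff] at hz1
  change TensorProduct.map (ρ p.1) (σ p.2) = -1
  by_cases h3 : p.1 = 1
  · have h4 : p.2 ≠ 1 := fun h4 => hz1 ⟨h1, h2, iff_of_true h3 h4⟩
    rw [h3, map_one, hσ _ h2 h4]
    ext v w
    simp [TensorProduct.tmul_neg]
  · have h4 : p.2 = 1 := by
      by_contra h4
      exact hz1 ⟨h1, h2, iff_of_false h3 h4⟩
    rw [h4, map_one, hρ _ h1 h3]
    ext v w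
    simp [TensorProduct.neg_tmul]

theorem exists_signOnCenter_Q2D4 (k : ℕ) :
    ∃ (V : Type) (_ : AddCommGroup V) (_ : Module ℂ V) (_ : FiniteDimensional ℂ V)
      (ρ : Representation ℂ (centralProdD4 Q2 k) V),
      SignOnCenter ρ ∧ Module.finrank ℂ V = 2 ^ (k + 1) := by
  induction k with
  | zero =>
    obtain ⟨ρ, hρ⟩ := exists_signOnCenter_Q2
    exact ⟨Fin 2 → ℂ, inferInstance, inferInstance, inferInstance, ρ, hρ, by simp⟩
  | succ k ih =>
    obtain ⟨V, _, _, _, ρ, hρ, hd⟩ := ih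
    obtain ⟨σ, hσ⟩ := exists_signOnCenter_D4
    obtain ⟨τ, hτ⟩ := exists_signOnCenter_centralProd hρ hσ
    refine ⟨V ⊗[ℂ] (Fin 2 → ℂ), inferInstance, inferInstance, inferInstance, τ, hτ, ?_⟩
    rw [Module.finrank_tensorProduct, hd, pow_succ _ (k + 1)]
    simp

/-- The representation of dimension 2^(k+1) need not be shown irreducible: a constituent inherits
the sign and is only smaller. -/
theorem not_isTotallyOrthogonal_Q2D4 (k : ℕ) : ¬ IsTotallyOrthogonal (centralProdD4 Q2 k) := by
  rintro ⟨-, h⟩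
  obtain ⟨V, _, _, _, ρ, hρ, hd⟩ := exists_signOnCenter_Q2D4 k
  have hnt : Nontrivial V := Module.nontrivial_of_finrank_pos (R := ℂ) (hd ▸ by positivity)
  obtain ⟨W, hW⟩ := exists_isIrreducible_subrepresentation ρ
  have hsign : SignOnCenter W.toRepresentation := fun z hz hz1 => by
    refine LinearMap.ext fun v => Subtype.ext ?_
    exact LinearMap.congr_fun (hρ z hz hz1) (v : V)
  have hWnt : Nontrivial W.toSubmodule := by
    rw [Submodule.nontrivial_iff_ne_bot]
    intro hbot
    have : Subsingleton W.toSubmodule := (Submodule.subsingleton_iff_eq_bot).2 hbot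
    have : (⊥ : Subrepresentation W.toRepresentation) = ⊤ :=
      Subrepresentation.toSubmodule_injective (Subsingleton.elim _ _)
    exact bot_ne_top this
  refine not_isRealizableOverReal k hsign ?_ (h W.toSubmodule W.toRepresentation hW)
  calc Module.finrank ℂ W.toSubmodule ≤ Module.finrank ℂ V := Submodule.finrank_le _
    _ = 2 ^ (k + 1) := hd
    _ < 2 ^ (k + 2) := Nat.pow_lt_pow_right one_lt_two (Nat.lt_succ_self _)

theorem isStronglyReal_D4Power : ∀ k, IsStronglyReal (centralProdD4 D4 k)
  | 0 => D4_isStronglyReal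
  | k + 1 => centralProd_D4_isStronglyReal (centralProdD4_sq_mem_center D4_sq_mem_center k)

theorem isTotallyOrthogonal_D4Power (k : ℕ) : IsTotallyOrthogonal (centralProdD4 D4 k) := by
  refine ⟨(isStronglyReal_D4Power k).isRealGroup, fun V _ _ _ ρ hρ => ?_⟩
  rcases signOnCenter_or_center_trivial hρ (card_center _) with h | h
  · exact isRealizableOverReal_of_signOnCenter k h
  · exact isRealizableOverReal_of_center_trivial hρ
      (centralProdD4_sq_mem_center D4_sq_mem_center k) h

theorem Q2_not_comm : ∃ x y : Q2, x * y ≠ y * x := by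
  have : ∃ x y : QuaternionGroup 2, x * y ≠ y * x := by decide
  exact this

end TwoCenteredGroup

theorem mainTheorem4 :
    (∀ n : ℕ, 2 ≤ n →
      IsExtraspecialTwoGroup (TwoCenteredGroup.Q2D4Power (n - 1)) ∧
      IsAssociatedQuadraticMap (TwoCenteredGroup.Q2D4Power (n - 1)) (ellipticForm (n - 1)) ∧
      (∃ a, a ≠ 0 ∧ HasArfInvariant (ellipticForm (n - 1)) a) ∧
      IsStronglyReal (TwoCenteredGroup.Q2D4Power (n - 1)) ∧
      ¬ IsTotallyOrthogonal (TwoCenteredGroup.Q2D4Power (n - 1))) ∧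
    (∀ n : ℕ, 1 ≤ n →
      IsExtraspecialTwoGroup (TwoCenteredGroup.D4Power n) ∧
      IsAssociatedQuadraticMap (TwoCenteredGroup.D4Power n) (hyperbolicForm n) ∧
      HasArfInvariant (hyperbolicForm n) 0 ∧
      IsStronglyReal (TwoCenteredGroup.D4Power n) ∧
      IsTotallyOrthogonal (TwoCenteredGroup.D4Power n)) := by
  open TwoCenteredGroup in
  refine ⟨fun n hn => ?_, fun n hn => ?_⟩
  -- Here n = k + 2, so at least one factor D₄ is present; Q₂ alone is not strongly real.
  · obtain ⟨k, rfl⟩ := Nat.exists_eq_add_of_le' hn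
    obtain ⟨f, hf⟩ := exists_isQuadraticModel_Q2D4Power (k + 1)
    exact ⟨centralProdD4_isExtraspecial Q2_sq_mem_center Q2_not_comm (k + 1),
      hf.isAssociatedQuadraticMap (card_center _),
      ⟨_, one_ne_zero_quotient_artinSchreier, ellipticForm_hasArfInvariant (k + 1)⟩,
      centralProd_D4_isStronglyReal (centralProdD4_sq_mem_center Q2_sq_mem_center k),
      not_isTotallyOrthogonal_Q2D4 (k + 1)⟩
  · obtain ⟨k, rfl⟩ := Nat.exists_eq_add_of_le' hn
    obtain ⟨f, hf⟩ := exists_isQuadraticModel_D4Power k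
    exact ⟨centralProdD4_isExtraspecial D4_sq_mem_center D4_not_comm k,
      hf.isAssociatedQuadraticMap (card_center _), hyperbolicForm_hasArfInvariant (k + 1),
      isStronglyReal_D4Power k, isTotallyOrthogonal_D4Power k⟩
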